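/- Let $K$ be a field and let $E=(E^0,E^1,s,r)$ be a finite directed graph (finitely many vertices and edges, at least one vertex; loops and multiple edges are allowed). Let $L_K(E)$ be its Leavitt path algebra, i.e. the associative (not necessarily unital) $K$-algebra generated by $\{v\mid v\in E^0\}\cup\{e,e^*\mid e\in E^1\}$ subject to the relations $vw=\delta_{vw}v$ for $v,w\in E^0$; $s(e)e=e=e\,r(e)$ and $r(e)e^*=e^*=e^*s(e)$ for $e\in E^1$; $e^*f=\delta_{ef}\,r(e)$ for $e,f\in E^1$; and $\sum_{e\in s^{-1}(v)}ee^*=v$ for every $v\in E^0$ with $s^{-1}(v)\neq\emptyset$. For a finite-dimensional subspace $W$ generating $L_K(E)$ and $n\ge 1$ let $d_W(n)$ be the dimension of the span of all products of at least one and at most $n$ elements of $W$; such $W$ exist. The algebra has polynomial growth if there are positive integers $m,c$ with $d_W(n)\le c\,(cn)^m$ for all $n\ge1$, and $\operatorname{GKdim} L_K(E):=\limsup_{n\to\infty}\log_n d_W(n)\in[-\infty,\infty]$; the statements below hold for every choice of $W$. A cyclic path is a path $e_1\cdots e_n$ with $n\ge1$, $r(e_i)=s(e_{i+1})$ for $i<n$,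 $r(e_n)=s(e_1)$, and $s(e_1),\dots,s(e_n)$ pairwise distinct; a cycle is a subgraph of $E$ consisting of the edges of a cyclic path and their sources and ranges. A chain of cycles of length $k$ is a sequence $C_1,\dots,C_k$ of pairwise distinct cycles such that for each $i<k$ there is a path (possibly of length $0$) from a vertex of $C_i$ to a vertex of $C_{i+1}$; it has an exit if some edge that is not in $C_k$ has its source in $C_k$. Let $d_1$ be the maximal length of a chain of cycles and $d_2$ the maximal length of a chain of cycles with an exit, a maximum being $0$ if there is no such chain (these maxima exist). Then: (i) $L_K(E)$ has polynomial growth if and only if any two distinct cycles have no common vertex. (ii) If $L_K(E)$ has polynomial growth, then $\operatorname{GKdim} L_K(E)=\max(2d_1-1,\,2d_2)$. -/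

import Mathlib

universe u v w

/-! ## Directed graphs, paths, cycles -/

/-- A directed graph with vertex set `V` and edge set `E`, given by its source and range maps. -/
structure DirectedGraph (V : Type u) (E : Type v) where
  s : E → V
  r : E → V

namespace DirectedGraph

variable {V : Type u} {E : Type v}

/-- `G.IsPath x p y`: the edge list `p = e₁ … eₙ` is a path of `G` with source `x` and range `y`.
The empty list is the path of length `0` at a vertex. -/
inductive IsPath (G : DirectedGraph V E) : V → List E → V → Prop
  | nil (x : V) : IsPath G x [] x
  | cons (e : E) {p : List E} {y : V} (h : IsPath G (G.r e) p y) : IsPath G (G.s e) (e :: p) y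

/-- A cyclic path: a path `e₁ … eₙ` with `n ≠ 0` whose source and range agree and such that
the sources `s(e₁), …, s(eₙ)` are pairwise distinct. -/
def IsCyclicPath (G : DirectedGraph V E) (p : List E) : Prop :=
  p ≠ [] ∧ (∃ x, G.IsPath x p x) ∧ (p.map G.s).Nodup

/-- A subgraph: a set of vertices and a set of edges that contains with each edge its source and
range. -/
@[ext]
structure Subgraph (G : DirectedGraph V E) where
  verts : Set V
  edges : Set E
  s_mem : ∀ e ∈ edges, G.s e ∈ verts
  r_mem : ∀ e ∈ edges, G.r e ∈ verts

/-- The subgraph that consists of the edges of `p` and their sources and ranges. -/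
def subgraphOf (G : DirectedGraph V E) (p : List E) : G.Subgraph where
  verts := {x | ∃ e ∈ p, x = G.s e ∨ x = G.r e}
  edges := {e | e ∈ p}
  s_mem := fun e he => ⟨e, he, Or.inl rfl⟩
  r_mem := fun e he => ⟨e, he, Or.inr rfl⟩

variable {G : DirectedGraph V E}

namespace Subgraph

/-- A cycle is the subgraph defined by a cyclic path. -/
def IsCycle (C : G.Subgraph) : Prop :=
  ∃ p, G.IsCyclicPath p ∧ C = G.subgraphOf p

/-- `C.Reaches D`: there is a path that starts at a vertex of `C` and ends at a vertex of `D`. -/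
def Reaches (C D : G.Subgraph) : Prop :=
  ∃ x ∈ C.verts, ∃ y ∈ D.verts, ∃ p, G.IsPath x p y

/-- There is an edge outside `C` that starts at a vertex of `C`. -/
def HasExit (C : G.Subgraph) : Prop :=
  ∃ e, G.s e ∈ C.verts ∧ e ∉ C.edges

end Subgraph

/-- A chain of cycles: a sequence `C₁, …, Cₖ` of pairwise distinct cycles such that there is a path
from each `Cᵢ` to `Cᵢ₊₁`. Its length is `k`; the empty sequence is the chain of length `0`. -/
def IsCycleChain (l : List G.Subgraph) : Prop :=
  (∀ C ∈ l, C.IsCycle) ∧ l.Nodup ∧ l.IsChain Subgraph.Reaches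

/-- A chain has an exit if its last cycle has one. The empty chain counts as having an exit, so that
the maximal length of a chain with an exit is `0` if no cycle has an exit. -/
def ChainHasExit (l : List G.Subgraph) : Prop :=
  ∀ C ∈ l.getLast?, C.HasExit

/-- `d` is the maximal length of a chain of cycles. -/
def IsMaxChainLength (G : DirectedGraph V E) (d : ℕ) : Prop :=
  IsGreatest {k | ∃ l : List G.Subgraph, IsCycleChain l ∧ l.length = k} d

/-- `d` is the maximal length of a chain of cycles with an exit. -/
def IsMaxChainWithExitLength (G : DirectedGraph V E) (d : ℕ) : Prop :=
  IsGreatest {k | ∃ l : List G.Subgraph, IsCycleChain l ∧ ChainHasExit l ∧ l.length = k} d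

end DirectedGraph

/-! ## Leavitt path algebras -/

namespace LeavittPath

/-- The generators: vertices, real edges `e` and ghost edges `e*`. -/
inductive Gen (V : Type u) (E : Type v) : Type (max u v)
  | vertex (x : V)
  | edge (e : E)
  | ghost (e : E)

/-- The free associative, not necessarily unital, `K`-algebra on the generators: its basis is the
set of nonempty words. -/
abbrev FreeAlg (K : Type w) [Field K] (V : Type u) (E : Type v) : Type (max u v w) :=
  MonoidAlgebra K (FreeSemigroup (Gen V E))

section

variable (K : Type w) [Field K] {V : Type u} {E : Type v}

/-- A generator as an element of the free algebra. -/
noncomputable def gen (g : Gen V E) : FreeAlg K V E :=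
  MonoidAlgebra.single (FreeSemigroup.of g) 1

open Gen in
/-- The defining relations of the Leavitt path algebra. -/
inductive Rel (G : DirectedGraph V E) : FreeAlg K V E → FreeAlg K V E → Prop
  | vertex_mul_self (x : V) : Rel G (gen K (vertex x) * gen K (vertex x)) (gen K (vertex x))
  | vertex_mul_of_ne (x y : V) (h : x ≠ y) : Rel G (gen K (vertex x) * gen K (vertex y)) 0
  | source_mul_edge (e : E) : Rel G (gen K (vertex (G.s e)) * gen K (edge e)) (gen K (edge e))
  | edge_mul_range (e : E) : Rel G (gen K (edge e) * gen K (vertex (G.r e))) (gen K (edge e))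
  | range_mul_ghost (e : E) : Rel G (gen K (vertex (G.r e)) * gen K (ghost e)) (gen K (ghost e))
  | ghost_mul_source (e : E) : Rel G (gen K (ghost e) * gen K (vertex (G.s e))) (gen K (ghost e))
  | ghost_mul_self (e : E) : Rel G (gen K (ghost e) * gen K (edge e)) (gen K (vertex (G.r e)))
  | ghost_mul_of_ne (e f : E) (h : e ≠ f) : Rel G (gen K (ghost e) * gen K (edge f)) 0
  | sum_edge_mul_ghost (x : V) (hfin : {e | G.s e = x}.Finite) (hne : {e | G.s e = x}.Nonempty) :
      Rel G (∑ e ∈ hfin.toFinset, gen K (edge e) * gen K (ghost e)) (gen K (vertex x))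

/-- The scalar multiples of the defining relations. They are needed to generate a `K`-linear ideal,
since the free algebra has no unit. -/
def SMulRel (G : DirectedGraph V E) (a b : FreeAlg K V E) : Prop :=
  ∃ (k : K) (a' b' : FreeAlg K V E), Rel K G a' b' ∧ a = k • a' ∧ b = k • b'

/-- The smallest `K`-algebra congruence that contains the defining relations. -/
noncomputable def con (G : DirectedGraph V E) : RingCon (FreeAlg K V E) :=
  ringConGen (SMulRel K G)

theorem con_smul (G : DirectedGraph V E) (k : K) {a b : FreeAlg K V E} (h : con K G a b) :
    con K G (k • a) (k • b) := by
  change RingConGen.Rel (SMulRel K G) a b at h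
  change RingConGen.Rel (SMulRel K G) (k • a) (k • b)
  induction h with
  | of x y h =>
    obtain ⟨c, x', y', h, rfl, rfl⟩ := h
    exact .of _ _ ⟨k * c, x', y', h, (mul_smul k c x').symm, (mul_smul k c y').symm⟩
  | refl x => exact .refl _
  | symm _ ih => exact ih.symm
  | trans _ _ ih₁ ih₂ => exact ih₁.trans ih₂
  | add _ _ ih₁ ih₂ => rw [smul_add, smul_add]; exact ih₁.add ih₂
  | mul _ h₂ ih₁ _ => rw [← smul_mul_assoc, ← smul_mul_assoc]; exact ih₁.mul h₂

end

end LeavittPath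

/-- The Leavitt path algebra `L_K(G)`: the free associative algebra on the vertices, edges and ghost
edges modulo the defining relations. -/
def LeavittPathAlgebra (K : Type w) [Field K] {V : Type u} {E : Type v} (G : DirectedGraph V E) :
    Type (max u v w) :=
  (LeavittPath.con K G).Quotient

namespace LeavittPathAlgebra

variable (K : Type w) [Field K] {V : Type u} {E : Type v} (G : DirectedGraph V E)

noncomputable instance : NonUnitalRing (LeavittPathAlgebra K G) :=
  inferInstanceAs (NonUnitalRing (LeavittPath.con K G).Quotient)

/-- The quotient map from the free algebra. -/
noncomputable def mk (a : LeavittPath.FreeAlg K V E) : LeavittPathAlgebra K G :=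
  RingCon.toQuotient a

noncomputable instance : SMul K (LeavittPathAlgebra K G) where
  smul k := Quotient.map' (fun a => k • a) fun _ _ h => LeavittPath.con_smul K G k h

noncomputable instance : Module K (LeavittPathAlgebra K G) where
  one_smul := Quotient.ind' fun a => congrArg (mk K G) (one_smul K a)
  mul_smul k l := Quotient.ind' fun a => congrArg (mk K G) (mul_smul k l a)
  smul_zero k := congrArg (mk K G) (smul_zero k)
  smul_add k := Quotient.ind₂' fun a b => congrArg (mk K G) (smul_add k a b)
  add_smul k l := Quotient.ind' fun a => congrArg (mk K G) (add_smul k l a)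
  zero_smul := Quotient.ind' fun a => congrArg (mk K G) (zero_smul K a)

instance : IsScalarTower K (LeavittPathAlgebra K G) (LeavittPathAlgebra K G) where
  smul_assoc k := Quotient.ind₂' fun a b => congrArg (mk K G) (smul_mul_assoc k a b)

instance : SMulCommClass K (LeavittPathAlgebra K G) (LeavittPathAlgebra K G) where
  smul_comm k := Quotient.ind₂' fun a b => congrArg (mk K G) (mul_smul_comm k a b).symm

end LeavittPathAlgebra

/-! ## Growth of algebras -/

namespace Growth

/-- `IsProd S k a`: `a` is a product `v₁ ⋯ vₖ` of `k ≥ 1` elements of `S`. -/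
inductive IsProd {A : Type u} [Mul A] (S : Set A) : ℕ → A → Prop
  | of {a : A} (h : a ∈ S) : IsProd S 1 a
  | mul {a b : A} {k : ℕ} (ha : a ∈ S) (hb : IsProd S k b) : IsProd S (k + 1) (a * b)

/-- `f ≼ g` for functions on the positive integers. -/
def AsympLE (f g : ℕ → ℝ) : Prop :=
  ∃ c : ℕ, 0 < c ∧ ∀ n : ℕ, 0 < n → f n ≤ c * g (c * n)

variable {K : Type v} [Field K] {A : Type u} [NonUnitalRing A] [Module K A]

/-- `W` is a finite-dimensional subspace that generates the (not necessarily unital) algebra `A`. -/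
def IsGeneratingSpace [IsScalarTower K A A] [SMulCommClass K A A] (W : Submodule K A) : Prop :=
  FiniteDimensional K W ∧ NonUnitalAlgebra.adjoin K (W : Set A) = ⊤

/-- `Wⁿ`, the span of all products of at least one and at most `n` elements of `W`. -/
def powSpan (W : Submodule K A) (n : ℕ) : Submodule K A :=
  Submodule.span K {a | ∃ k ≤ n, IsProd (W : Set A) k a}

/-- `d_W(n) = dim Wⁿ`. -/
noncomputable def growthFun (W : Submodule K A) (n : ℕ) : ℕ :=
  Module.finrank K (powSpan W n)

/-- Polynomial growth, tested on the generating space `W`: `d_W ≼ n^m` for some `m ≥ 1`. -/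
def HasPolynomialGrowth (W : Submodule K A) : Prop :=
  ∃ m : ℕ, 0 < m ∧ AsympLE (fun n => (growthFun W n : ℝ)) (fun n => (n : ℝ) ^ m)

/-- The Gelfand-Kirillov dimension, computed on the generating space `W`:
`limsup log_n d_W(n)` as an extended real number. -/
noncomputable def gkDim (W : Submodule K A) : EReal :=
  Filter.limsup (fun n : ℕ => ((Real.logb n (growthFun W n) : ℝ) : EReal)) Filter.atTop

end Growth

/-! Among the edges leaving a vertex one is chosen as special. The relations write every element as
a combination of products p q* of paths with a common range, and the relation ∑ e e* = v eliminates
those in which p and q end with the same special edge. The remaining normal products form a basis.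
They span, because multiplication by a generator can be rewritten (`linearCombination_genAct`). They
are independent, because the rewriting rules define a representation on the free vector space on the
triples, in which each normal p q* sends one fixed vector to its own triple (`rep_ofTriple`). So for
every W, d_W(n) is, up to rescaling n, the number of normal triples with at most n edges
(`growthFun_bounds`).

The rest is counting. Two closed paths c, d along distinct cycles at a common vertex do not commute,
and words in cd and dc give exponentially many paths (`exists_two_pow_le`). If the cycles are
disjoint, a path runs through the cycles of a chain and is determined, up to boundedly many choices,
by its numbers of turns. Hence the paths to x grow with degree at most `rank x`, the maximal length
of a chain that reaches x (`CyclesDisjoint.pathBound`); conversely, a chain of k cycles yields about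
N ^ k paths (`CyclesDisjoint.manyPaths`, `ManyPaths.cycle`).

Pairs (p, q) double the degree. If the last cycle of the chain has no exit, x lies on it and all its
edges are special, so p and q cannot both end in it: one power is lost and 2k - 1 remains. If it has
an exit, both paths can leave it through a nonspecial edge, every pair is normal, and the degree 2k
is attained. -/

/-! ## Normal forms and their representation -/

namespace DirectedGraph

variable {V : Type u} {E : Type v} (G : DirectedGraph V E)

/-- The source of the edge list `p`, read as a path that ends at `x`. -/
def src : List E → V → V
  | [], x => x
  | e :: _, _ => G.s e

/-- `p` is a path that ends at `x`. -/
def IsPathTo : List E → V → Prop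
  | [], _ => True
  | e :: p, x => G.r e = G.src p x ∧ IsPathTo p x

/-- The reversal of the edge list is a path that ends at `x`. -/
def IsCopath : V → List E → Prop
  | _, [] => True
  | x, f :: q => G.r f = x ∧ IsCopath (G.s f) q

variable {G}

theorem isPath_iff {y x : V} {p : List E} : G.IsPath y p x ↔ G.src p x = y ∧ G.IsPathTo p x := by
  induction p generalizing y with
  | nil =>
    constructor
    · rintro ⟨⟩; exact ⟨rfl, trivial⟩
    · rintro ⟨rfl, -⟩; exact .nil _
  | cons e p ih =>
    constructor
    · rintro (_ | ⟨_, h⟩)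
      have := ih.1 h
      exact ⟨rfl, this.1.symm, this.2⟩
    · rintro ⟨rfl, h, h'⟩
      exact .cons e (ih.2 ⟨h.symm, h'⟩)

theorem isPath_nil_iff {y x : V} : G.IsPath y [] x ↔ x = y := by
  simp [isPath_iff, src, IsPathTo]

theorem isPath_cons_iff {y x : V} {e : E} {p : List E} :
    G.IsPath y (e :: p) x ↔ G.s e = y ∧ G.IsPath (G.r e) p x := by
  simp [isPath_iff, src, IsPathTo, eq_comm]

theorem isPath_append_iff {y x : V} {p q : List E} :
    G.IsPath y (p ++ q) x ↔ ∃ z, G.IsPath y p z ∧ G.IsPath z q x := by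
  induction p generalizing y with
  | nil => simp [isPath_nil_iff]
  | cons e p ih => simp [isPath_cons_iff, ih, and_assoc]

theorem IsPath.append {x y z : V} {p q : List E} (hp : G.IsPath x p y) (hq : G.IsPath y q z) :
    G.IsPath x (p ++ q) z :=
  isPath_append_iff.2 ⟨y, hp, hq⟩

theorem isPath_singleton (e : E) : G.IsPath (G.s e) [e] (G.r e) := .cons e (.nil _)

theorem IsPath.isPathTo {y x : V} {p : List E} (h : G.IsPath y p x) : G.IsPathTo p x :=
  (isPath_iff.1 h).2

theorem IsPathTo.isPath {x : V} {p : List E} (h : G.IsPathTo p x) : G.IsPath (G.src p x) p x :=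
  isPath_iff.2 ⟨rfl, h⟩

theorem isCopath_iff_exists {x : V} {q : List E} :
    G.IsCopath x q ↔ ∃ y, G.IsPath y q.reverse x := by
  induction q generalizing x with
  | nil => simp [IsCopath, isPath_nil_iff]
  | cons e q ih =>
    simp only [IsCopath, List.reverse_cons, isPath_append_iff, isPath_cons_iff, isPath_nil_iff, ih]
    constructor
    · rintro ⟨h, y, hy⟩; exact ⟨y, _, hy, rfl, h.symm⟩
    · rintro ⟨y, _, hy, rfl, h⟩; exact ⟨h.symm, y, hy⟩

theorem isCopath_reverse_iff {x : V} {p : List E} : G.IsCopath x p.reverse ↔ G.IsPathTo p x := by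
  rw [isCopath_iff_exists, List.reverse_reverse]
  exact ⟨fun ⟨_, h⟩ => h.isPathTo, fun h => ⟨_, h.isPath⟩⟩

variable (G) in
/-- A choice of one edge, the special one, among all edges with the same source as `e`. -/
noncomputable def special (e : E) : E := (Quotient.mk (Setoid.ker G.s) e).out

@[simp]
theorem s_special (e : E) : G.s (G.special e) = G.s e :=
  Quotient.mk_out (s := Setoid.ker G.s) e

theorem special_eq_of_s_eq {e f : E} (h : G.s e = G.s f) : G.special e = G.special f :=
  congrArg Quotient.out (Quotient.sound (s := Setoid.ker G.s) h)

@[simp]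
theorem special_special (e : E) : G.special (G.special e) = G.special e :=
  special_eq_of_s_eq (s_special e)

variable (G) in
/-- The triple `(p, x, q)` stands for `p q*`, where `q` is reversed and `x` is the common range.
It is normal unless `p` and `q` end with the same special edge. -/
def IsNormal (t : List E × V × List E) : Prop :=
  G.IsPathTo t.1 t.2.1 ∧ G.IsCopath t.2.1 t.2.2 ∧
    ∀ e, t.1.getLast? = some e → t.2.2.head? = some e → G.special e ≠ e

/-- The number of edges in a triple. -/
def tripleLength (t : List E × V × List E) : ℕ := t.1.length + t.2.2.length

theorem IsNormal.nil {x : V} {q : List E} (h : G.IsCopath x q) : G.IsNormal ([], x, q) :=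
  ⟨trivial, h, by simp⟩

theorem IsNormal.tail {e : E} {p q : List E} {x : V} (h : G.IsNormal (e :: p, x, q)) :
    G.IsNormal (p, x, q) := by
  refine ⟨h.1.2, h.2.1, fun f hf => h.2.2 f ?_⟩
  cases p with
  | nil => simp at hf
  | cons a p => simpa [List.getLast?_cons_cons] using hf

theorem isNormal_edge {e : E} {x : V} {q : List E} (ht : G.IsNormal ([], x, q))
    (hx : G.r e = x) (h : ¬ (q.head? = some e ∧ G.special e = e)) : G.IsNormal ([e], x, q) := by
  refine ⟨⟨hx, trivial⟩, ht.2.1, ?_⟩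
  intro f hf hq
  obtain rfl : e = f := by simpa using hf
  exact fun hs => h ⟨hq, hs⟩

theorem isNormal_edge_cons {e f : E} {x : V} {p q : List E} (ht : G.IsNormal (f :: p, x, q))
    (hx : G.r e = G.s f) : G.IsNormal (e :: f :: p, x, q) :=
  ⟨⟨hx, ht.1⟩, ht.2.1, by simpa [List.getLast?_cons_cons] using ht.2.2⟩

theorem isNormal_ghost {e : E} {x : V} {q : List E} (ht : G.IsNormal ([], x, q))
    (hx : G.s e = x) : G.IsNormal ([], G.r e, e :: q) :=
  .nil ⟨rfl, hx ▸ ht.2.1⟩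

/-- The operators `genOp` vanish on triples that are not normal, so identities between them have
content only on normal ones; the other hypothesis is settled by `genOp_single_of_not`. -/
theorem ext_on_normal (K : Type w) [Field K] {M : Type*} [AddCommMonoid M] [Module K M]
    {φ ψ : (List E × V × List E →₀ K) →ₗ[K] M}
    (hn : ∀ t, G.IsNormal t → φ (.single t 1) = ψ (.single t 1))
    (h0 : ∀ t, ¬ G.IsNormal t → φ (.single t 1) = ψ (.single t 1)) : φ = ψ := by
  refine Finsupp.lhom_ext' fun t => LinearMap.ext_ring ?_
  by_cases ht : G.IsNormal t
  · exact hn t ht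
  · exact h0 t ht

end DirectedGraph

namespace LeavittPath

open DirectedGraph Gen

variable (K : Type w) [Field K] {V : Type u} {E : Type v} [Fintype E] (G : DirectedGraph V E)

open Classical in
/-- The edges with the same source as `e`, without `e`. -/
noncomputable def siblings (e : E) : Finset E :=
  Finset.univ.filter fun h => G.s h = G.s e ∧ h ≠ e

variable {G} in
theorem mem_siblings {e h : E} : h ∈ siblings G e ↔ G.s h = G.s e ∧ h ≠ e := by
  simp [siblings]

open Classical in
/-- The normal form of the product of a generator and a normal triple. -/
noncomputable def genAct : Gen V E → List E × V × List E → (List E × V × List E →₀ K)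
  | vertex y, (p, x, q) => if G.src p x = y then .single (p, x, q) 1 else 0
  | edge e, ([], x, q) =>
    if G.r e = x then
      if q.head? = some e ∧ G.special e = e then
        -- Here q starts with the special edge e, so e q* contains e e*, which is rewritten as the
        -- source vertex minus the products h h* over the siblings. No sibling is special, so the
        -- result is already normal.
        .single ([], G.s e, q.tail) 1 - ∑ h ∈ siblings G e, .single ([h], G.r h, h :: q.tail) 1
      else .single ([e], x, q) 1
    else 0
  | edge e, (f :: p, x, q) => if G.r e = G.s f then .single (e :: f :: p, x, q) 1 else 0
  | ghost e, ([], x, q) => if G.s e = x then .single ([], G.r e, e :: q) 1 else 0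
  | ghost e, (f :: p, x, q) => if f = e then .single (p, x, q) 1 else 0

open Classical in
/-- The operator by which a generator acts on the space with basis the triples. Triples that are not
normal are annihilated. -/
noncomputable def genOp (g : Gen V E) : Module.End K (List E × V × List E →₀ K) :=
  Finsupp.linearCombination K fun t => if G.IsNormal t then genAct K G g t else 0

variable {G}

theorem genOp_single {t : List E × V × List E} (ht : G.IsNormal t) (g : Gen V E) :
    genOp K G g (.single t 1) = genAct K G g t := by
  simp [genOp, ht]

theorem genOp_single_of_not {t : List E × V × List E} (ht : ¬ G.IsNormal t) (g : Gen V E) :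
    genOp K G g (.single t 1) = 0 := by
  simp [genOp, ht]

theorem isNormal_sibling {e h : E} {q : List E} (hh : h ∈ siblings G e)
    (he : G.special e = e) (hq : G.IsCopath (G.s e) q) : G.IsNormal ([h], G.r h, h :: q) := by
  rw [mem_siblings] at hh
  refine ⟨⟨rfl, trivial⟩, ⟨rfl, hh.1 ▸ hq⟩, ?_⟩
  intro f hf _
  obtain rfl : h = f := by simpa using hf
  rw [special_eq_of_s_eq hh.1, he]
  exact hh.2.symm

/-- The triples in the product of a generator and a normal triple are normal. -/
theorem genAct_mem_supported (g : Gen V E) {t : List E × V × List E} (ht : G.IsNormal t) :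
    genAct K G g t ∈
      Finsupp.supported K K {t' | G.IsNormal t' ∧ tripleLength t' ≤ tripleLength t + 1} := by
  obtain ⟨p, x, q⟩ := t
  match g, p with
  | vertex y, p =>
    simp only [genAct]
    split_ifs
    · exact Finsupp.single_mem_supported K _ ⟨ht, Nat.le_succ _⟩
    · exact zero_mem _
  | edge e, [] =>
    simp only [genAct]
    split_ifs with h h'
    · obtain ⟨h', hs⟩ := h'
      cases q with
      | nil => simp at h'
      | cons f q =>
        obtain rfl : f = e := by simpa using h'
        refine sub_mem (Finsupp.single_mem_supported K _ ⟨.nil ht.2.1.2, ?_⟩)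
          (sum_mem fun h hh => Finsupp.single_mem_supported K _
            ⟨isNormal_sibling hh hs ht.2.1.2, ?_⟩) <;> simp [tripleLength]
        · omega
        · omega
    · exact Finsupp.single_mem_supported K _ ⟨isNormal_edge ht h h', by simp [tripleLength]; omega⟩
    · exact zero_mem _
  | edge e, f :: p =>
    simp only [genAct]
    split_ifs with h
    · exact Finsupp.single_mem_supported K _
        ⟨isNormal_edge_cons ht h, by simp [tripleLength]; omega⟩
    · exact zero_mem _
  | ghost e, [] =>
    simp only [genAct]
    split_ifs with h
    · exact Finsupp.single_mem_supported K _ ⟨isNormal_ghost ht h, by simp [tripleLength]⟩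
    · exact zero_mem _
  | ghost e, f :: p =>
    simp only [genAct]
    split_ifs with h
    · exact Finsupp.single_mem_supported K _ ⟨ht.tail, by simp [tripleLength]; omega⟩
    · exact zero_mem _

/-! ### The operators satisfy the defining relations -/

theorem genOp_vertex_mul (x y : V) [Decidable (x = y)] :
    genOp K G (vertex x) * genOp K G (vertex y) = if x = y then genOp K G (vertex x) else 0 := by
  refine ext_on_normal K (G := G) (fun t ht => ?_) (fun t ht => ?_)
  · obtain ⟨p, z, q⟩ := t
    rw [Module.End.mul_apply, genOp_single K ht, genAct]
    split_ifs with h h' h'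
    · simp [genOp_single K ht, genAct, h, h']
    · simp [genOp_single K ht, genAct, h, Ne.symm h']
    · subst h'; simp [genOp_single K ht, genAct, h]
    · simp
  · rw [Module.End.mul_apply, genOp_single_of_not K ht]
    split_ifs <;> simp [genOp_single_of_not K ht]

theorem genOp_source_mul_edge (e : E) :
    genOp K G (vertex (G.s e)) * genOp K G (edge e) = genOp K G (edge e) := by
  refine ext_on_normal K (G := G) (fun t ht => ?_) (fun t ht => ?_)
  · obtain ⟨_ | ⟨f, p⟩, x, q⟩ := t
    · rw [Module.End.mul_apply, genOp_single K ht, genAct]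
      split_ifs with h h'
      · obtain ⟨h', hs⟩ := h'
        cases q with
        | nil => simp at h'
        | cons f q =>
          obtain rfl : f = e := by simpa using h'
          rw [List.tail_cons, map_sub, map_sum, genOp_single K (.nil ht.2.1.2), genAct]
          rw [Finset.sum_congr rfl fun h hh => by
            rw [genOp_single K (isNormal_sibling hh hs ht.2.1.2), genAct, src,
              if_pos (mem_siblings.1 hh).1]]
          simp [src]
      · rw [genOp_single K (isNormal_edge ht h h'), genAct, src, if_pos rfl]
      · simp
    · rw [Module.End.mul_apply, genOp_single K ht, genAct]
      split_ifs with h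
      · rw [genOp_single K (isNormal_edge_cons ht h), genAct, src, if_pos rfl]
      · simp
  · simp [genOp_single_of_not K ht]

theorem genOp_edge_mul_range (e : E) :
    genOp K G (edge e) * genOp K G (vertex (G.r e)) = genOp K G (edge e) := by
  refine ext_on_normal K (G := G) (fun t ht => ?_) (fun t ht => ?_)
  · obtain ⟨p, x, q⟩ := t
    rw [Module.End.mul_apply, genOp_single K ht (vertex _), genAct]
    split_ifs with h
    · rfl
    · rw [map_zero, genOp_single K ht]
      cases p <;> simp only [src] at h <;> simp [genAct, Ne.symm h]
  · simp [genOp_single_of_not K ht]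

theorem genOp_range_mul_ghost (e : E) :
    genOp K G (vertex (G.r e)) * genOp K G (ghost e) = genOp K G (ghost e) := by
  refine ext_on_normal K (G := G) (fun t ht => ?_) (fun t ht => ?_)
  · obtain ⟨_ | ⟨f, p⟩, x, q⟩ := t
    · rw [Module.End.mul_apply, genOp_single K ht, genAct]
      split_ifs with h
      · rw [genOp_single K (isNormal_ghost ht h), genAct, src, if_pos rfl]
      · simp
    · rw [Module.End.mul_apply, genOp_single K ht, genAct]
      split_ifs with h
      · subst h
        rw [genOp_single K ht.tail, genAct, if_pos ht.1.1.symm]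
      · simp
  · simp [genOp_single_of_not K ht]

theorem genOp_ghost_mul_source (e : E) :
    genOp K G (ghost e) * genOp K G (vertex (G.s e)) = genOp K G (ghost e) := by
  refine ext_on_normal K (G := G) (fun t ht => ?_) (fun t ht => ?_)
  · obtain ⟨p, x, q⟩ := t
    rw [Module.End.mul_apply, genOp_single K ht (vertex _), genAct]
    split_ifs with h
    · rfl
    · rw [map_zero, genOp_single K ht]
      cases p with
      | nil => simp only [src] at h; simp [genAct, Ne.symm h]
      | cons f p =>
        have : f ≠ e := by rintro rfl; exact h rfl
        simp [genAct, this]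
  · simp [genOp_single_of_not K ht]

theorem genOp_ghost_mul_edge (e f : E) [Decidable (e = f)] :
    genOp K G (ghost e) * genOp K G (edge f) =
      if e = f then genOp K G (vertex (G.r e)) else 0 := by
  classical
  refine ext_on_normal K (G := G) (fun t ht => ?_) (fun t ht => ?_)
  · obtain ⟨_ | ⟨g, p⟩, x, q⟩ := t
    · rw [Module.End.mul_apply, genOp_single K ht, genAct]
      split_ifs with h h' hef hef hef
      · obtain ⟨h', hs⟩ := h'
        cases q with
        | nil => simp at h'
        | cons g q =>
          obtain rfl : g = f := by simpa using h'
          subst hef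
          rw [List.tail_cons, map_sub, map_sum, genOp_single K (.nil ht.2.1.2), genAct]
          rw [Finset.sum_congr rfl fun h hh => by
            rw [genOp_single K (isNormal_sibling hh hs ht.2.1.2), genAct,
              if_neg (mem_siblings.1 hh).2]]
          simp [genOp_single K ht, genAct, src, h]
      · obtain ⟨h', hs⟩ := h'
        cases q with
        | nil => simp at h'
        | cons g q =>
          obtain rfl : g = f := by simpa using h'
          rw [List.tail_cons, map_sub, map_sum, genOp_single K (.nil ht.2.1.2), genAct]
          rw [Finset.sum_congr rfl fun h hh => by
            rw [genOp_single K (isNormal_sibling hh hs ht.2.1.2), genAct]]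
          -- If e is a sibling of g, the summand h = e cancels the image of the vertex term under
          -- e*; otherwise e* kills everything.
          by_cases hse : G.s e = G.s g
          · have : e ∈ siblings G g := mem_siblings.2 ⟨hse, hef⟩
            simp [hse, this]
          · have : e ∉ siblings G g := fun h => hse (mem_siblings.1 h).1
            simp [hse, this]
      · rw [genOp_single K (isNormal_edge ht h h'), genAct, genOp_single K ht, genAct]
        simp [hef, src, h]
      · rw [genOp_single K (isNormal_edge ht h h'), genAct]
        simp [Ne.symm hef]
      · subst hef
        simp [genOp_single K ht, genAct, src, Ne.symm h]
      · simp
    · rw [Module.End.mul_apply, genOp_single K ht, genAct]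
      split_ifs with h hef hef
      · subst hef
        simp [genOp_single K (isNormal_edge_cons ht h), genOp_single K ht, genAct, src, h]
      · simp [genOp_single K (isNormal_edge_cons ht h), genAct, Ne.symm hef]
      · subst hef
        simp [genOp_single K ht, genAct, src, Ne.symm h]
      · simp
  · split_ifs <;> simp [genOp_single_of_not K ht]

/-- For empty p at x, the special edge contributes the vertex term minus all sibling terms, and the
other edges contribute exactly those sibling terms. For p starting with g, only e = g survives: g is
removed and, by normality, put back without rewriting. -/
theorem sum_genOp_edge_mul_ghost (x : V) (s : Finset E) (hs : ∀ e, e ∈ s ↔ G.s e = x)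
    (hne : s.Nonempty) :
    ∑ e ∈ s, genOp K G (edge e) * genOp K G (ghost e) = genOp K G (vertex x) := by
  classical
  refine ext_on_normal K (G := G) (fun t ht => ?_) (fun t ht => ?_)
  · rw [LinearMap.sum_apply]
    obtain ⟨_ | ⟨g, p⟩, y, q⟩ := t
    · by_cases hxy : y = x
      · subst hxy
        obtain ⟨e₀, he₀⟩ := hne
        have hsp : G.special e₀ ∈ s := by rw [hs, s_special, ← hs]; exact he₀
        have hsib : s.erase (G.special e₀) = siblings G (G.special e₀) := by
          ext h
          rw [Finset.mem_erase, mem_siblings, hs, (hs _).1 hsp, and_comm]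
        rw [← Finset.add_sum_erase _ _ hsp, hsib, Module.End.mul_apply, genOp_single K ht, genAct,
          if_pos ((hs _).1 hsp), genOp_single K (isNormal_ghost ht ((hs _).1 hsp)), genAct,
          if_pos rfl, if_pos (by simp), List.tail_cons]
        have hsum : ∀ h ∈ siblings G (G.special e₀),
            (genOp K G (edge h) * genOp K G (ghost h)) (.single ([], y, q) 1) =
              .single ([h], G.r h, h :: q) 1 := by
          intro h hh
          rw [mem_siblings, (hs _).1 hsp] at hh
          rw [Module.End.mul_apply, genOp_single K ht, genAct, if_pos hh.1,
            genOp_single K (isNormal_ghost ht hh.1), genAct, if_pos rfl, if_neg]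
          rintro ⟨-, h'⟩
          apply hh.2
          rw [← h', special_eq_of_s_eq (hh.1.trans ((hs e₀).1 he₀).symm)]
        rw [Finset.sum_congr rfl hsum, sub_add_cancel, genOp_single K ht, genAct, src, if_pos rfl,
          (hs _).1 hsp]
      · rw [Finset.sum_eq_zero]
        · simp [genOp_single K ht, genAct, src, hxy]
        · intro e he
          have : G.s e ≠ y := fun h => hxy (h ▸ (hs e).1 he)
          simp [genOp_single K ht, genAct, this]
    · have key : ∀ e, (genOp K G (edge e) * genOp K G (ghost e)) (.single (g :: p, y, q) 1) =
          if g = e then .single (g :: p, y, q) 1 else 0 := by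
        intro e
        rw [Module.End.mul_apply, genOp_single K ht, genAct]
        split_ifs with h
        · subst h
          rw [genOp_single K ht.tail]
          cases p with
          | nil =>
            have h1 := ht.1.1
            rw [src] at h1
            rw [genAct, if_pos h1, if_neg]
            rintro ⟨h2, h3⟩
            exact ht.2.2 g rfl h2 h3
          | cons f p => rw [genAct, if_pos (show G.r g = G.s f from ht.1.1)]
        · simp
      simp only [key, genOp_single K ht, genAct, src, Finset.sum_ite_eq, hs]
      congr
  · simp [genOp_single_of_not K ht]

end LeavittPath

/-! ## A basis of the Leavitt path algebra -/

namespace LeavittPathAlgebra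

open DirectedGraph LeavittPath Gen Growth

variable (K : Type w) [Field K] {V : Type u} {E : Type v} (G : DirectedGraph V E)

/-- The quotient map as a homomorphism. -/
noncomputable def mkHom : FreeAlg K V E →ₙₐ[K] LeavittPathAlgebra K G where
  toFun := mk K G
  map_smul' _ _ := rfl
  map_zero' := rfl
  map_add' _ _ := rfl
  map_mul' _ _ := rfl

theorem mkHom_surjective : Function.Surjective (mkHom K G) := Quotient.mk_surjective

/-- A generator as an element of the Leavitt path algebra. -/
noncomputable def ofGen (g : Gen V E) : LeavittPathAlgebra K G := mkHom K G (gen K g)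

variable {K G} in
theorem mkHom_eq_of_rel {a b : FreeAlg K V E} (h : Rel K G a b) : mkHom K G a = mkHom K G b :=
  Quotient.sound (.of _ _ ⟨1, a, b, h, (one_smul _ _).symm, (one_smul _ _).symm⟩)

theorem ofGen_vertex_mul_self (x : V) :
    ofGen K G (vertex x) * ofGen K G (vertex x) = ofGen K G (vertex x) := by
  simpa [ofGen, map_mul] using mkHom_eq_of_rel (.vertex_mul_self (K := K) (G := G) x)

theorem ofGen_vertex_mul_of_ne {x y : V} (h : x ≠ y) :
    ofGen K G (vertex x) * ofGen K G (vertex y) = 0 := by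
  simpa [ofGen, map_mul] using mkHom_eq_of_rel (.vertex_mul_of_ne (K := K) (G := G) x y h)

theorem ofGen_source_mul_edge (e : E) :
    ofGen K G (vertex (G.s e)) * ofGen K G (edge e) = ofGen K G (edge e) := by
  simpa [ofGen, map_mul] using mkHom_eq_of_rel (.source_mul_edge (K := K) (G := G) e)

theorem ofGen_edge_mul_range (e : E) :
    ofGen K G (edge e) * ofGen K G (vertex (G.r e)) = ofGen K G (edge e) := by
  simpa [ofGen, map_mul] using mkHom_eq_of_rel (.edge_mul_range (K := K) (G := G) e)

theorem ofGen_range_mul_ghost (e : E) :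
    ofGen K G (vertex (G.r e)) * ofGen K G (ghost e) = ofGen K G (ghost e) := by
  simpa [ofGen, map_mul] using mkHom_eq_of_rel (.range_mul_ghost (K := K) (G := G) e)

theorem ofGen_ghost_mul_source (e : E) :
    ofGen K G (ghost e) * ofGen K G (vertex (G.s e)) = ofGen K G (ghost e) := by
  simpa [ofGen, map_mul] using mkHom_eq_of_rel (.ghost_mul_source (K := K) (G := G) e)

theorem ofGen_ghost_mul_self (e : E) :
    ofGen K G (ghost e) * ofGen K G (edge e) = ofGen K G (vertex (G.r e)) := by
  simpa [ofGen, map_mul] using mkHom_eq_of_rel (.ghost_mul_self (K := K) (G := G) e)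

theorem ofGen_ghost_mul_of_ne {e f : E} (h : e ≠ f) :
    ofGen K G (ghost e) * ofGen K G (edge f) = 0 := by
  simpa [ofGen, map_mul] using mkHom_eq_of_rel (.ghost_mul_of_ne (K := K) (G := G) e f h)

/-- The element `q*`, for the reversal `q` of a path that ends at `x`. -/
noncomputable def ghostPath : V → List E → LeavittPathAlgebra K G
  | x, [] => ofGen K G (vertex x)
  | _, f :: q => ofGen K G (ghost f) * ghostPath (G.s f) q

/-- The element `p q*` that corresponds to the triple `(p, x, q)`. -/
noncomputable def ofTriple (t : List E × V × List E) : LeavittPathAlgebra K G :=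
  t.1.foldr (fun e a => ofGen K G (edge e) * a) (ghostPath K G t.2.1 t.2.2)

@[simp]
theorem ofTriple_nil (x : V) (q : List E) : ofTriple K G ([], x, q) = ghostPath K G x q := rfl

@[simp]
theorem ofTriple_cons (e : E) (p : List E) (x : V) (q : List E) :
    ofTriple K G (e :: p, x, q) = ofGen K G (edge e) * ofTriple K G (p, x, q) := rfl

variable {G}

theorem vertex_mul_ghostPath {x : V} {q : List E} (h : G.IsCopath x q) :
    ofGen K G (vertex x) * ghostPath K G x q = ghostPath K G x q := by
  cases q with
  | nil => exact ofGen_vertex_mul_self K G x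
  | cons f q =>
    obtain ⟨rfl, -⟩ := h
    rw [ghostPath, ← mul_assoc, ofGen_range_mul_ghost]

theorem vertex_mul_ofTriple {p q : List E} {x : V} (h : G.IsCopath x q) :
    ofGen K G (vertex (G.src p x)) * ofTriple K G (p, x, q) = ofTriple K G (p, x, q) := by
  cases p with
  | nil => exact vertex_mul_ghostPath K h
  | cons e p => rw [ofTriple_cons, src, ← mul_assoc, ofGen_source_mul_edge]

theorem vertex_mul_ofTriple_of_ne {p q : List E} {x y : V} (h : G.IsCopath x q)
    (hy : y ≠ G.src p x) : ofGen K G (vertex y) * ofTriple K G (p, x, q) = 0 := by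
  rw [← vertex_mul_ofTriple K h, ← mul_assoc, ofGen_vertex_mul_of_ne K G hy, zero_mul]

variable [Fintype E]

/-- The last relation solved for one summand; this is the rule that removes a special edge from the
middle of p q*. -/
theorem edge_mul_ghost_eq_sub {e : E} :
    ofGen K G (edge e) * ofGen K G (ghost e) = ofGen K G (vertex (G.s e)) -
      ∑ h ∈ siblings G e, ofGen K G (edge h) * ofGen K G (ghost h) := by
  classical
  have h := mkHom_eq_of_rel (.sum_edge_mul_ghost (K := K) (G := G) (G.s e) (Set.toFinite _) ⟨e, rfl⟩)
  rw [map_sum, ← Finset.add_sum_erase _ _ (a := e) (by simp)] at h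
  have hs : (Set.toFinite {f | G.s f = G.s e}).toFinset.erase e = siblings G e := by
    ext f; simp [mem_siblings, and_comm]
  rw [hs] at h
  simp only [map_mul] at h
  exact eq_sub_of_add_eq h

/-- It identifies `genAct` with left multiplication in the algebra, which is the spanning half of
the basis theorem. -/
theorem linearCombination_genAct (g : Gen V E) {t : List E × V × List E} (ht : G.IsNormal t) :
    Finsupp.linearCombination K (ofTriple K G) (genAct K G g t) = ofGen K G g * ofTriple K G t := by
  obtain ⟨p, x, q⟩ := t
  have hq := ht.2.1
  match g, p with
  | vertex y, p =>
    rw [genAct]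
    split_ifs with h
    · simp [← h, vertex_mul_ofTriple K hq]
    · simp [vertex_mul_ofTriple_of_ne K hq (Ne.symm h)]
  | edge e, [] =>
    rw [genAct]
    split_ifs with h h'
    · obtain ⟨h', hs⟩ := h'
      cases q with
      | nil => simp at h'
      | cons f q =>
        obtain rfl : f = e := by simpa using h'
        rw [List.tail_cons, map_sub, map_sum, ofTriple_nil, ghostPath, ← mul_assoc,
          edge_mul_ghost_eq_sub, sub_mul, vertex_mul_ghostPath K hq.2, Finset.sum_mul]
        congr 1
        · simp
        · refine Finset.sum_congr rfl fun h hh => ?_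
          simp [ghostPath, mul_assoc, (mem_siblings.1 hh).1]
    · simp
    · rw [map_zero, ← ofGen_edge_mul_range, mul_assoc, vertex_mul_ofTriple_of_ne K hq h, mul_zero]
  | edge e, f :: p =>
    rw [genAct]
    split_ifs with h
    · simp
    · rw [map_zero, ← ofGen_edge_mul_range, mul_assoc, vertex_mul_ofTriple_of_ne K hq h, mul_zero]
  | ghost e, [] =>
    rw [genAct]
    split_ifs with h
    · simp [ghostPath, h]
    · rw [map_zero, ← ofGen_ghost_mul_source, mul_assoc, vertex_mul_ofTriple_of_ne K hq h, mul_zero]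
  | ghost e, f :: p =>
    rw [genAct]
    split_ifs with h
    · subst h
      rw [ofTriple_cons, ← mul_assoc, ofGen_ghost_mul_self, ht.1.1, vertex_mul_ofTriple K hq]
      simp
    · rw [map_zero, ofTriple_cons, ← mul_assoc, ofGen_ghost_mul_of_ne K G (Ne.symm h), zero_mul]

/-! ### The representation on triples and linear independence -/

variable (G) in
/-- The homomorphism from the free algebra given by the operators `genOp`. -/
noncomputable def freeRep : FreeAlg K V E →ₙₐ[K] Module.End K (List E × V × List E →₀ K) :=
  MonoidAlgebra.liftMagma K (FreeSemigroup.lift (genOp K G))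

theorem freeRep_gen (g : Gen V E) : freeRep K G (gen K g) = genOp K G g := by
  simp [freeRep, gen, MonoidAlgebra.liftMagma]

theorem freeRep_eq_of_rel {a b : FreeAlg K V E} (h : Rel K G a b) :
    freeRep K G a = freeRep K G b := by
  classical
  cases h with
  | vertex_mul_self x => simp [freeRep_gen, genOp_vertex_mul]
  | vertex_mul_of_ne x y h => simp [freeRep_gen, genOp_vertex_mul, h]
  | source_mul_edge e => simp [freeRep_gen, genOp_source_mul_edge]
  | edge_mul_range e => simp [freeRep_gen, genOp_edge_mul_range]
  | range_mul_ghost e => simp [freeRep_gen, genOp_range_mul_ghost]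
  | ghost_mul_source e => simp [freeRep_gen, genOp_ghost_mul_source]
  | ghost_mul_self e => simp [freeRep_gen, genOp_ghost_mul_edge]
  | ghost_mul_of_ne e f h => simp [freeRep_gen, genOp_ghost_mul_edge, h]
  | sum_edge_mul_ghost x hfin hne =>
    rw [map_sum, freeRep_gen,
      ← sum_genOp_edge_mul_ghost K x hfin.toFinset (by simp)
        (hfin.toFinset_nonempty.2 hne)]
    simp [freeRep_gen]

theorem freeRep_eq_of_con {a b : FreeAlg K V E} (h : con K G a b) :
    freeRep K G a = freeRep K G b := by
  change RingConGen.Rel (SMulRel K G) a b at h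
  induction h with
  | of x y h =>
    obtain ⟨c, x', y', h, rfl, rfl⟩ := h
    rw [map_smul, map_smul, freeRep_eq_of_rel K h]
  | refl x => rfl
  | symm _ ih => exact ih.symm
  | trans _ _ ih₁ ih₂ => exact ih₁.trans ih₂
  | add _ _ ih₁ ih₂ => rw [map_add, map_add, ih₁, ih₂]
  | mul _ _ ih₁ ih₂ => rw [map_mul, map_mul, ih₁, ih₂]

variable (G) in
/-- The representation of the Leavitt path algebra on the space with basis the triples. -/
noncomputable def rep :
    LeavittPathAlgebra K G →ₙₐ[K] Module.End K (List E × V × List E →₀ K) where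
  toFun := Quotient.lift (freeRep K G) fun _ _ h => freeRep_eq_of_con K h
  map_smul' k := Quotient.ind fun a => map_smul (freeRep K G) k a
  map_zero' := map_zero (freeRep K G)
  map_add' := Quotient.ind₂ fun a b => map_add (freeRep K G) a b
  map_mul' := Quotient.ind₂ fun a b => map_mul (freeRep K G) a b

theorem rep_ofGen (g : Gen V E) : rep K G (ofGen K G g) = genOp K G g := freeRep_gen K g

/-- The sum of all vertex triples is a separating vector: the innermost vertex of q* projects it to
one summand, and the ghost edges rebuild q from there. -/
theorem rep_ghostPath [Fintype V] {x : V} {q : List E} (h : G.IsCopath x q) :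
    rep K G (ghostPath K G x q) (∑ y, .single ([], y, []) 1) = .single ([], x, q) 1 := by
  classical
  induction q generalizing x with
  | nil =>
    have hy : ∀ y : V, genOp K G (vertex x) (.single ([], y, []) 1) =
        if y = x then .single ([], y, []) 1 else 0 := fun y => by
      rw [genOp_single K (IsNormal.nil (G := G) (q := []) trivial), genAct, src]
    rw [ghostPath, rep_ofGen, map_sum, Finset.sum_congr rfl fun y _ => hy y]
    simp
  | cons f q ih =>
    rw [ghostPath, map_mul, Module.End.mul_apply, ih h.2, rep_ofGen, genOp_single K (.nil h.2),
      genAct, if_pos rfl, h.1]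

/-- Normality ensures that prepending the edges of p triggers no rewriting, not even where p meets
q. -/
theorem rep_ofTriple [Fintype V] {t : List E × V × List E} (ht : G.IsNormal t) :
    rep K G (ofTriple K G t) (∑ y, .single ([], y, []) 1) = .single t 1 := by
  obtain ⟨p, x, q⟩ := t
  induction p with
  | nil => exact rep_ghostPath K ht.2.1
  | cons e p ih =>
    rw [ofTriple_cons, map_mul, Module.End.mul_apply, ih ht.tail, rep_ofGen,
      genOp_single K ht.tail]
    cases p with
    | nil =>
      rw [genAct, if_pos (show G.r e = x from ht.1.1), if_neg]
      rintro ⟨h2, h3⟩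
      exact ht.2.2 e rfl h2 h3
    | cons f p => rw [genAct, if_pos (show G.r e = G.s f from ht.1.1)]

theorem linearIndependent_ofTriple [Finite V] :
    LinearIndependent K fun t : {t // G.IsNormal t} => ofTriple K G t := by
  cases nonempty_fintype V
  let ev : LeavittPathAlgebra K G →ₗ[K] (List E × V × List E →₀ K) :=
    { toFun := fun a => rep K G a (∑ y, .single ([], y, []) 1)
      map_add' := fun a b => by rw [map_add, LinearMap.add_apply]
      map_smul' := fun k a => by rw [map_smul, LinearMap.smul_apply, RingHom.id_apply] }
  apply LinearIndependent.of_comp ev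
  have : (ev ∘ fun t : {t // G.IsNormal t} => ofTriple K G t) =
      (fun t => Finsupp.single t (1 : K)) ∘ Subtype.val :=
    funext fun t => rep_ofTriple K t.2
  rw [this]
  exact (Finsupp.linearIndependent_single_one K _).comp _ Subtype.val_injective

end LeavittPathAlgebra

/-! ## Growth functions and generating spaces -/

namespace Growth

variable {K : Type v} [Field K] {A : Type u} [NonUnitalRing A] [Module K A]

theorem IsProd.mul_isProd {S : Set A} {k l : ℕ} {a b : A} (ha : IsProd S k a) (hb : IsProd S l b) :
    IsProd S (k + l) (a * b) := by
  induction ha with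
  | of h => rw [add_comm]; exact .mul h hb
  | mul h _ ih => rw [mul_assoc, add_right_comm]; exact .mul h ih

theorem powSpan_mono (W : Submodule K A) : Monotone (powSpan W) := fun _ _ h =>
  Submodule.span_mono fun _ ⟨k, hk, ha⟩ => ⟨k, hk.trans h, ha⟩

theorem IsProd.mem_powSpan {W : Submodule K A} {k : ℕ} {a : A} (h : IsProd (W : Set A) k a) :
    a ∈ powSpan W k :=
  Submodule.subset_span ⟨k, le_rfl, h⟩

variable [IsScalarTower K A A] [SMulCommClass K A A]

theorem mul_mem_powSpan {W : Submodule K A} {m n : ℕ} {a b : A} (ha : a ∈ powSpan W m)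
    (hb : b ∈ powSpan W n) : a * b ∈ powSpan W (m + n) := by
  induction ha using Submodule.span_induction with
  | zero => rw [zero_mul]; exact zero_mem _
  | add x y _ _ hx hy => rw [add_mul]; exact add_mem hx hy
  | smul k x _ hx => rw [smul_mul_assoc]; exact Submodule.smul_mem _ _ hx
  | mem x hx =>
    obtain ⟨k, hk, hx⟩ := hx
    induction hb using Submodule.span_induction with
    | zero => rw [mul_zero]; exact zero_mem _
    | add x y _ _ hx hy => rw [mul_add]; exact add_mem hx hy
    | smul k x _ hx => rw [mul_smul_comm]; exact Submodule.smul_mem _ _ hx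
    | mem y hy =>
      obtain ⟨l, hl, hy⟩ := hy
      exact powSpan_mono W (Nat.add_le_add hk hl) (hx.mul_isProd hy).mem_powSpan

theorem exists_mem_powSpan {W : Submodule K A} (hW : IsGeneratingSpace W) (a : A) :
    ∃ n, a ∈ powSpan W n := by
  have ha : a ∈ NonUnitalAlgebra.adjoin K (W : Set A) := by rw [hW.2]; trivial
  induction ha using NonUnitalAlgebra.adjoin_induction with
  | mem x hx => exact ⟨1, IsProd.mem_powSpan (.of hx)⟩
  | add x y _ _ hx hy =>
    obtain ⟨m, hm⟩ := hx
    obtain ⟨n, hn⟩ := hy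
    exact ⟨max m n, add_mem (powSpan_mono W (le_max_left _ _) hm)
      (powSpan_mono W (le_max_right _ _) hn)⟩
  | zero => exact ⟨0, zero_mem _⟩
  | mul x y _ _ hx hy =>
    obtain ⟨m, hm⟩ := hx
    obtain ⟨n, hn⟩ := hy
    exact ⟨m + n, mul_mem_powSpan hm hn⟩
  | smul k x _ hx =>
    obtain ⟨n, hn⟩ := hx
    exact ⟨n, Submodule.smul_mem _ _ hn⟩

/-- Finitely many spanning elements of W' lie in a common power of W. Together with
`powSpan_le_of_le` this compares the growth of any two generating spaces up to scaling n. -/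
theorem exists_le_powSpan {W W' : Submodule K A} (hW : IsGeneratingSpace W)
    [FiniteDimensional K W'] : ∃ c, 0 < c ∧ W' ≤ powSpan W c := by
  obtain ⟨s, hs⟩ := (Submodule.fg_iff_finiteDimensional W').2 inferInstance
  choose n hn using exists_mem_powSpan hW
  refine ⟨s.sup n + 1, Nat.succ_pos _, ?_⟩
  rw [← hs, Submodule.span_le]
  exact fun a ha => powSpan_mono W ((Finset.le_sup ha).trans (Nat.le_succ _)) (hn a)

theorem powSpan_le_of_le {W W' : Submodule K A} {c : ℕ} (h : W' ≤ powSpan W c) (n : ℕ) :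
    powSpan W' n ≤ powSpan W (c * n) := by
  refine Submodule.span_le.2 ?_
  rintro a ⟨k, hk, ha⟩
  refine powSpan_mono W (Nat.mul_le_mul_left c hk) ?_
  clear hk
  induction ha with
  | of ha => rw [mul_one]; exact h ha
  | mul ha _ ih => rw [mul_add, mul_one, add_comm]; exact mul_mem_powSpan (h ha) ih

end Growth

/-! ### Growth in terms of normal triples -/

namespace LeavittPathAlgebra

open DirectedGraph LeavittPath Gen Growth

variable (K : Type w) [Field K] {V : Type u} {E : Type v} (G : DirectedGraph V E)

/-- The space spanned by the generators. -/
noncomputable def genSpace : Submodule K (LeavittPathAlgebra K G) :=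
  Submodule.span K (Set.range (ofGen K G))

variable {G} in
theorem ofGen_mem_genSpace (g : Gen V E) : ofGen K G g ∈ genSpace K G :=
  Submodule.subset_span ⟨g, rfl⟩

/-- The normal triples with at most `n` edges. -/
def _root_.DirectedGraph.normalTriples (n : ℕ) : Set (List E × V × List E) :=
  {t | G.IsNormal t ∧ tripleLength t ≤ n}

theorem _root_.DirectedGraph.finite_normalTriples [Finite V] [Finite E] (n : ℕ) :
    (G.normalTriples n).Finite := by
  refine (((List.finite_length_le E n).prod
    (Set.finite_univ.prod (List.finite_length_le E n)))).subset ?_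
  rintro ⟨p, x, q⟩ ⟨-, h⟩
  simp only [tripleLength] at h
  exact ⟨show p.length ≤ n by omega, trivial, show q.length ≤ n by omega⟩

variable {G} in
theorem _root_.DirectedGraph.normalTriples_mono : Monotone G.normalTriples :=
  fun _ _ h _ ht => ⟨ht.1, ht.2.trans h⟩

variable {G}

theorem ofTriple_isProd (t : List E × V × List E) :
    IsProd (genSpace K G : Set (LeavittPathAlgebra K G)) (tripleLength t + 1) (ofTriple K G t) := by
  obtain ⟨p, x, q⟩ := t
  induction p with
  | nil =>
    induction q generalizing x with
    | nil => exact .of (ofGen_mem_genSpace K _)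
    | cons f q ih =>
      have := IsProd.mul (ofGen_mem_genSpace K (ghost f)) (ih (G.s f))
      simpa [tripleLength, ghostPath] using this
  | cons e p ih =>
    have := IsProd.mul (ofGen_mem_genSpace K (edge e)) ih
    simpa [tripleLength, add_right_comm] using this

theorem span_le_powSpan_genSpace (n : ℕ) :
    Submodule.span K (ofTriple K G '' G.normalTriples n) ≤ powSpan (genSpace K G) (n + 1) := by
  refine Submodule.span_le.2 ?_
  rintro _ ⟨t, ht, rfl⟩
  exact powSpan_mono _ (Nat.add_le_add_right ht.2 1) (ofTriple_isProd K t).mem_powSpan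

variable [Fintype E]

/-- Products of at most `n` generators are combinations of normal triples with at most `n` edges. -/
theorem powSpan_genSpace_le (n : ℕ) :
    powSpan (genSpace K G) n ≤ Submodule.span K (ofTriple K G '' G.normalTriples n) := by
  refine Submodule.span_le.2 ?_
  rintro a ⟨k, hk, ha⟩
  refine Submodule.span_mono (Set.image_mono (normalTriples_mono hk)) ?_
  clear hk
  induction ha with
  | @of a h =>
    refine (Submodule.span_le.2 ?_ : genSpace K G ≤ _) h
    rintro _ ⟨g, rfl⟩
    refine Submodule.subset_span ?_
    match g with
    | vertex x => exact ⟨([], x, []), ⟨.nil trivial, by simp [tripleLength]⟩, rfl⟩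
    | edge e =>
      exact ⟨([e], G.r e, []), ⟨⟨⟨rfl, trivial⟩, trivial, by simp⟩, by simp [tripleLength]⟩,
        ofGen_edge_mul_range K G e⟩
    | ghost e =>
      exact ⟨([], G.r e, [e]), ⟨.nil ⟨rfl, trivial⟩, by simp [tripleLength]⟩,
        ofGen_ghost_mul_source K G e⟩
  | @mul a b k ha hb ih =>
    clear hb
    induction ha using Submodule.span_induction with
    | zero => rw [zero_mul]; exact zero_mem _
    | add x y _ _ hx hy => rw [add_mul]; exact add_mem hx hy
    | smul k x _ hx => rw [smul_mul_assoc]; exact Submodule.smul_mem _ _ hx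
    | mem x hx =>
      obtain ⟨g, rfl⟩ := hx
      induction ih using Submodule.span_induction with
      | zero => rw [mul_zero]; exact zero_mem _
      | add x y _ _ hx hy => rw [mul_add]; exact add_mem hx hy
      | smul k x _ hx => rw [mul_smul_comm]; exact Submodule.smul_mem _ _ hx
      | mem y hy =>
        obtain ⟨t, ht, rfl⟩ := hy
        rw [← linearCombination_genAct K g ht.1,
          Finsupp.mem_span_image_iff_linearCombination]
        refine ⟨_, Finsupp.supported_mono ?_ (genAct_mem_supported K g ht.1), rfl⟩
        exact fun t' ht' => ⟨ht'.1, ht'.2.trans (Nat.add_le_add_right ht.2 1)⟩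

theorem finrank_span_ofTriple [Finite V] (n : ℕ) :
    Module.finrank K (Submodule.span K (ofTriple K G '' G.normalTriples n)) =
      (G.normalTriples n).ncard := by
  have hli : LinearIndepOn K (ofTriple K G) (G.normalTriples n) :=
    LinearIndepOn.mono (show LinearIndepOn K (ofTriple K G) {t | G.IsNormal t} from
      linearIndependent_ofTriple K) fun t ht => ht.1
  have := (G.finite_normalTriples n).fintype
  rw [Set.image_eq_range, finrank_span_eq_card hli,
    ← Nat.card_eq_fintype_card, Nat.card_coe_set_eq]

theorem finiteDimensional_span_ofTriple [Finite V] (n : ℕ) :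
    FiniteDimensional K (Submodule.span K (ofTriple K G '' G.normalTriples n)) :=
  FiniteDimensional.span_of_finite K ((G.finite_normalTriples n).image _)

variable (G)

theorem isGeneratingSpace_genSpace [Finite V] : IsGeneratingSpace (genSpace K G) := by
  have : Finite (Gen V E) := by
    refine Finite.of_surjective (α := V ⊕ E ⊕ E)
      (Sum.elim vertex (Sum.elim edge ghost)) ?_
    rintro (x | e | e)
    exacts [⟨.inl x, rfl⟩, ⟨.inr (.inl e), rfl⟩, ⟨.inr (.inr e), rfl⟩]
  refine ⟨FiniteDimensional.span_of_finite K (Set.finite_range _), ?_⟩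
  refine eq_top_iff.2 fun a _ => ?_
  obtain ⟨a, rfl⟩ := mkHom_surjective K G a
  induction a using MonoidAlgebra.induction_linear with
  | zero => rw [map_zero]; exact zero_mem _
  | add a b ha hb => rw [map_add]; exact add_mem (ha trivial) (hb trivial)
  | single w k =>
    have : (MonoidAlgebra.single w k : FreeAlg K V E) = k • MonoidAlgebra.single w 1 := by simp
    rw [this, map_smul]
    refine SMulMemClass.smul_mem _ ?_
    clear this
    induction w using FreeSemigroup.recOnMul with
    | ih1 g => exact NonUnitalAlgebra.subset_adjoin K (ofGen_mem_genSpace K g)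
    | ih2 g w h1 h2 =>
      have : (MonoidAlgebra.single (FreeSemigroup.of g * w) 1 : FreeAlg K V E) =
          MonoidAlgebra.single (FreeSemigroup.of g) 1 * MonoidAlgebra.single w 1 := by simp
      rw [this, map_mul]
      exact mul_mem (h1 trivial) (h2 trivial)

variable {G}

/-- The growth of a Leavitt path algebra on any generating space is that of the number of normal
triples. -/
theorem growthFun_bounds [Finite V] {W : Submodule K (LeavittPathAlgebra K G)}
    (hW : IsGeneratingSpace W) :
    Monotone (growthFun W) ∧ ∃ c, 0 < c ∧ ∀ n, growthFun W n ≤ (G.normalTriples (c * n)).ncard ∧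
      (G.normalTriples n).ncard ≤ growthFun W (c * (n + 1)) := by
  have := hW.1
  have hG := isGeneratingSpace_genSpace K G
  have := hG.1
  obtain ⟨c₁, hc₁, h₁⟩ := exists_le_powSpan hG (W' := W)
  obtain ⟨c₂, hc₂, h₂⟩ := exists_le_powSpan hW (W' := genSpace K G)
  have hup : ∀ n, powSpan W n ≤ Submodule.span K (ofTriple K G '' G.normalTriples (c₁ * n)) :=
    fun n => (powSpan_le_of_le h₁ n).trans (powSpan_genSpace_le K _)
  have hfd := finiteDimensional_span_ofTriple K (G := G)
  have hfin : ∀ n, FiniteDimensional K (powSpan W n) := fun n =>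
    Submodule.finiteDimensional_of_le (hup n)
  have hmono : Monotone (growthFun W) := fun m n h =>
    Submodule.finrank_mono (powSpan_mono W h)
  refine ⟨hmono, max c₁ c₂, lt_max_of_lt_left hc₁, fun n => ⟨?_, ?_⟩⟩
  · rw [← finrank_span_ofTriple K]
    exact Submodule.finrank_mono ((hup n).trans
      (Submodule.span_mono (Set.image_mono (normalTriples_mono
        (Nat.mul_le_mul_right n (le_max_left c₁ c₂))))))
  · rw [← finrank_span_ofTriple K]
    refine (Submodule.finrank_mono ((span_le_powSpan_genSpace K n).trans
      (powSpan_le_of_le h₂ (n + 1)))).trans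
      (hmono (Nat.mul_le_mul_right _ (le_max_right c₁ c₂)))

end LeavittPathAlgebra

/-! ## Cycles, reachability and ranks of vertices -/

namespace DirectedGraph

variable {V : Type u} {E : Type v} {G : DirectedGraph V E}

variable (G) in
/-- There is a path from `x` to `y`. -/
def Reach (x y : V) : Prop := ∃ p, G.IsPath x p y

theorem Reach.refl (x : V) : G.Reach x x := ⟨[], .nil x⟩

theorem Reach.trans {x y z : V} : G.Reach x y → G.Reach y z → G.Reach x z
  | ⟨p, hp⟩, ⟨q, hq⟩ => ⟨p ++ q, hp.append hq⟩

theorem reach_edge (e : E) : G.Reach (G.s e) (G.r e) := ⟨[e], isPath_singleton e⟩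

variable (G) in
/-- Any two distinct cycles have no common vertex. -/
def CyclesDisjoint : Prop :=
  ∀ C D : G.Subgraph, C.IsCycle → D.IsCycle → C ≠ D → Disjoint C.verts D.verts

theorem CyclesDisjoint.eq (H : G.CyclesDisjoint) {C D : G.Subgraph} (hC : C.IsCycle)
    (hD : D.IsCycle) {x : V} (hxC : x ∈ C.verts) (hxD : x ∈ D.verts) : C = D := by
  by_contra h
  exact Set.disjoint_left.1 (H C D hC hD h) hxC hxD

theorem IsPath.exists_s_eq {x y : V} {p : List E} (h : G.IsPath x p y) (hp : p ≠ []) :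
    ∃ e ∈ p, G.s e = x := by
  cases p with
  | nil => exact absurd rfl hp
  | cons e p => exact ⟨e, by simp, (isPath_cons_iff.1 h).1⟩

theorem IsPath.r_eq_or_exists {x y : V} {p : List E} (h : G.IsPath x p y) {e : E} (he : e ∈ p) :
    G.r e = y ∨ ∃ f ∈ p, G.s f = G.r e := by
  induction h with
  | nil => simp at he
  | @cons f p y h ih =>
    rcases List.mem_cons.1 he with rfl | he
    · by_cases hp : p = []
      · subst hp
        exact .inl (isPath_nil_iff.1 h).symm
      · obtain ⟨g, hg, hs⟩ := h.exists_s_eq hp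
        exact .inr ⟨g, List.mem_cons_of_mem _ hg, hs⟩
    · rcases ih he with h' | ⟨g, hg, hs⟩
      · exact .inl h'
      · exact .inr ⟨g, List.mem_cons_of_mem _ hg, hs⟩

theorem IsPath.exists_mem_s_eq {x y : V} {p : List E} (h : G.IsPath x p x)
    (hy : y ∈ (G.subgraphOf p).verts) : ∃ e ∈ p, G.s e = y := by
  obtain ⟨e, he, rfl | rfl⟩ := hy
  · exact ⟨e, he, rfl⟩
  · rcases h.r_eq_or_exists he with h' | h'
    · rw [h']
      exact h.exists_s_eq (List.ne_nil_of_mem he)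
    · assumption

/-- A cycle is given by a closed path at any of its vertices. -/
theorem Subgraph.IsCycle.exists_isPath {C : G.Subgraph} (hC : C.IsCycle) {x : V}
    (hx : x ∈ C.verts) :
    ∃ p, p ≠ [] ∧ G.IsPath x p x ∧ (p.map G.s).Nodup ∧ C = G.subgraphOf p := by
  obtain ⟨p, ⟨-, ⟨y, hy⟩, hnd⟩, rfl⟩ := hC
  obtain ⟨e, he, rfl⟩ := hy.exists_mem_s_eq hx
  obtain ⟨a, b, rfl⟩ := List.append_of_mem he
  obtain ⟨z, ha, hb⟩ := isPath_append_iff.1 hy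
  obtain rfl := (isPath_cons_iff.1 hb).1
  refine ⟨e :: b ++ a, by simp, hb.append ha, ?_, ?_⟩
  · rw [List.map_append] at hnd ⊢
    exact List.nodup_append_comm.1 hnd
  · ext
    · simp only [subgraphOf, List.mem_append, or_comm]
    · simp only [subgraphOf, List.mem_append, or_comm]

theorem Subgraph.IsCycle.reach {C : G.Subgraph} (hC : C.IsCycle) {x y : V} (hx : x ∈ C.verts)
    (hy : y ∈ C.verts) : G.Reach x y := by
  obtain ⟨p, -, hp, -, rfl⟩ := hC.exists_isPath hx
  obtain ⟨e, he, rfl⟩ := hp.exists_mem_s_eq hy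
  obtain ⟨a, b, rfl⟩ := List.append_of_mem he
  obtain ⟨z, ha, hb⟩ := isPath_append_iff.1 hp
  obtain rfl := (isPath_cons_iff.1 hb).1
  exact ⟨a, ha⟩

theorem Subgraph.IsCycle.s_injOn {C : G.Subgraph} (hC : C.IsCycle) : Set.InjOn G.s C.edges := by
  obtain ⟨p, ⟨-, -, hnd⟩, rfl⟩ := hC
  exact List.inj_on_of_nodup_map hnd

theorem IsPath.getLast?_eq {x z : V} {e₀ e : E} {p : List E} (h : G.IsPath x (e₀ :: p) z)
    (hz : z ∉ p.map G.s) (he : e ∈ e₀ :: p) (hr : G.r e = z) : (e₀ :: p).getLast? = some e := by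
  induction p generalizing e₀ x with
  | nil =>
    obtain rfl : e = e₀ := by simpa using he
    rfl
  | cons f p ih =>
    have h' := (isPath_cons_iff.1 h).2
    rw [List.getLast?_cons_cons]
    rcases List.mem_cons.1 he with rfl | he
    · exact absurd ((isPath_cons_iff.1 h').1.trans hr) fun h => hz (by simp [← h])
    · exact ih h' (fun h => hz (by rw [List.map_cons]; exact List.mem_cons_of_mem _ h)) he

/-- Start the cycle at the common range z. Only its first edge has source z, so an edge with range z
must be its last one. -/
theorem Subgraph.IsCycle.r_injOn {C : G.Subgraph} (hC : C.IsCycle) : Set.InjOn G.r C.edges := by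
  intro e he f hf hef
  obtain ⟨p, hne, hp, hnd, rfl⟩ := hC.exists_isPath (C.r_mem e he)
  cases p with
  | nil => exact absurd rfl hne
  | cons e₀ p =>
    have hz : G.r e ∉ p.map G.s := by
      rw [← (isPath_cons_iff.1 hp).1]
      exact (List.nodup_cons.1 hnd).1
    exact Option.some_injective _
      ((hp.getLast?_eq hz he rfl).symm.trans (hp.getLast?_eq hz hf hef.symm))

theorem exists_append_of_not_nodup {q : List E} (h : ¬ (q.map G.s).Nodup) :
    ∃ a f b g c, q = a ++ f :: (b ++ g :: c) ∧ G.s f = G.s g := by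
  induction q with
  | nil => simp at h
  | cons e q ih =>
    rw [List.map_cons, List.nodup_cons, not_and_or, not_not] at h
    rcases h with h | h
    · obtain ⟨g, hg, hs⟩ := List.mem_map.1 h
      obtain ⟨b, c, rfl⟩ := List.append_of_mem hg
      exact ⟨[], e, b, g, c, rfl, hs.symm⟩
    · obtain ⟨a, f, b, g, c, rfl, hs⟩ := ih h
      exact ⟨e :: a, f, b, g, c, rfl, hs⟩

/-- A closed path that visits a vertex twice splits into two shorter closed paths. -/
theorem IsPath.split {x : V} {a b c : List E} {f g : E}
    (h : G.IsPath x (a ++ f :: (b ++ g :: c)) x) (hs : G.s f = G.s g) :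
    G.IsPath x (a ++ g :: c) x ∧ G.IsPath (G.s g) (f :: b) (G.s g) := by
  obtain ⟨y, ha, h⟩ := isPath_append_iff.1 h
  rw [← List.cons_append] at h
  obtain ⟨z, hb, hc⟩ := isPath_append_iff.1 h
  obtain rfl := (isPath_cons_iff.1 hc).1
  obtain rfl := (isPath_cons_iff.1 hb).1
  exact ⟨ha.append (hs ▸ hc), hs ▸ hb⟩

/-- At a repeated vertex the inner closed part is cut out; the remainder is shorter, nonempty and
still closed at x. -/
theorem exists_isCycle_of_isPath {x : V} {q : List E} (h : G.IsPath x q x) (hq : q ≠ []) :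
    ∃ C : G.Subgraph, C.IsCycle ∧ x ∈ C.verts := by
  induction hn : q.length using Nat.strong_induction_on generalizing q with
  | _ n ih =>
    by_cases hnd : (q.map G.s).Nodup
    · obtain ⟨e, he, rfl⟩ := h.exists_s_eq hq
      exact ⟨G.subgraphOf q, ⟨q, ⟨hq, ⟨_, h⟩, hnd⟩, rfl⟩, e, he, .inl rfl⟩
    · obtain ⟨a, f, b, g, c, rfl, hs⟩ := exists_append_of_not_nodup hnd
      refine ih _ ?_ (h.split hs).1 (by simp) rfl
      subst hn
      simp only [List.length_append, List.length_cons]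
      omega

/-- If cycles are disjoint, then a closed path at a vertex of a cycle stays in the cycle. -/
theorem CyclesDisjoint.mem_edges (H : G.CyclesDisjoint) {C : G.Subgraph} (hC : C.IsCycle) {x : V}
    (hx : x ∈ C.verts) {q : List E} (h : G.IsPath x q x) {e : E} (he : e ∈ q) : e ∈ C.edges := by
  induction hn : q.length using Nat.strong_induction_on generalizing q x e with
  | _ n ih =>
    by_cases hnd : (q.map G.s).Nodup
    · have hq : q ≠ [] := List.ne_nil_of_mem he
      obtain ⟨f, hf, hfx⟩ := h.exists_s_eq hq
      have := H.eq hC ⟨q, ⟨hq, ⟨_, h⟩, hnd⟩, rfl⟩ hx ⟨f, hf, .inl hfx.symm⟩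
      rw [this]
      exact he
    · obtain ⟨a, f, b, g, c, rfl, hs⟩ := exists_append_of_not_nodup hnd
      obtain ⟨h₁, h₂⟩ := h.split hs
      simp only [List.length_append, List.length_cons] at hn
      -- The outer path comes first: it shows that the base point of the inner closed path lies in
      -- C.
      have key : ∀ e ∈ a ++ g :: c, e ∈ C.edges := fun e he =>
        ih _ (by simp only [List.length_append, List.length_cons]; omega) hx h₁ he rfl
      have hg : G.s g ∈ C.verts := C.s_mem _ (key g (by simp))
      have key' : ∀ e ∈ f :: b, e ∈ C.edges := fun e he =>
        ih _ (by simp only [List.length_cons]; omega) hg h₂ he rfl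
      simp only [List.mem_append, List.mem_cons] at he key key'
      rcases he with he | he | he | he | he
      exacts [key e (.inl he), key' e (.inl he), key' e (.inr he), key e (.inr (.inl he)),
        key e (.inr (.inr he))]

theorem CyclesDisjoint.mem_edges_of_reach (H : G.CyclesDisjoint) {C : G.Subgraph} (hC : C.IsCycle)
    {x : V} (hx : x ∈ C.verts) {e : E} (h₁ : G.Reach x (G.s e)) (h₂ : G.Reach (G.r e) x) :
    e ∈ C.edges := by
  obtain ⟨p, hp⟩ := h₁
  obtain ⟨q, hq⟩ := h₂
  exact H.mem_edges hC hx (hp.append (.cons e hq)) (by simp)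

/-- The last cycle of the chain, if any, has a path to `x`. -/
def ChainReaches (l : List G.Subgraph) (x : V) : Prop :=
  ∀ C ∈ l.getLast?, ∃ y ∈ C.verts, G.Reach y x

theorem IsCycleChain.tail {C : G.Subgraph} {l : List G.Subgraph} (h : IsCycleChain (C :: l)) :
    IsCycleChain l :=
  ⟨fun D hD => h.1 D (List.mem_cons_of_mem _ hD), (List.nodup_cons.1 h.2.1).2, h.2.2.tail⟩

theorem IsCycleChain.reach_of_mem {l : List G.Subgraph} (hl : IsCycleChain l) {x : V}
    (hx : ChainReaches l x) {C : G.Subgraph} (hC : C ∈ l) : ∃ y ∈ C.verts, G.Reach y x := by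
  induction l generalizing C with
  | nil => simp at hC
  | cons D l ih =>
    cases l with
    | nil =>
      obtain rfl : C = D := by simpa using hC
      exact hx C rfl
    | cons D' l =>
      have ih' := @ih hl.tail (by simpa [ChainReaches, List.getLast?_cons_cons] using hx)
      rcases List.mem_cons.1 hC with rfl | hC
      · obtain ⟨y, hy, hyx⟩ := @ih' D' (by simp)
        obtain ⟨a, ha, b, hb, hab⟩ := (List.isChain_cons_cons.1 hl.2.2).1
        exact ⟨a, ha, .trans hab (((hl.1 D' (by simp)).reach hb hy).trans hyx)⟩
      · exact ih' hC

instance [Finite V] [Finite E] : Finite G.Subgraph :=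
  Finite.of_injective (fun C : G.Subgraph => (C.verts, C.edges)) fun C D h => by
    ext1
    exacts [congrArg Prod.fst h, congrArg Prod.snd h]

theorem IsCycleChain.length_le [Finite V] [Finite E] {l : List G.Subgraph} (hl : IsCycleChain l) :
    l.length ≤ Nat.card G.Subgraph := by
  have := Fintype.ofFinite G.Subgraph
  rw [Nat.card_eq_fintype_card]
  exact hl.2.1.length_le_card

theorem isCycleChain_nil : IsCycleChain ([] : List G.Subgraph) := by
  simp [IsCycleChain]

variable (G) in
/-- The maximal length of a chain of cycles that reaches `x`. -/
noncomputable def rank (x : V) : ℕ :=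
  sSup {k | ∃ l : List G.Subgraph, IsCycleChain l ∧ ChainReaches l x ∧ l.length = k}

section

variable [Finite V] [Finite E]

theorem exists_length_eq_rank (x : V) :
    ∃ l : List G.Subgraph, IsCycleChain l ∧ ChainReaches l x ∧ l.length = G.rank x := by
  refine Nat.sSup_mem (s := {k | ∃ l : List G.Subgraph, IsCycleChain l ∧ ChainReaches l x ∧
    l.length = k}) ⟨0, [], isCycleChain_nil, by simp [ChainReaches], rfl⟩
    ⟨Nat.card G.Subgraph, ?_⟩
  rintro k ⟨l, hl, -, rfl⟩
  exact hl.length_le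

theorem IsCycleChain.length_le_rank {l : List G.Subgraph} (hl : IsCycleChain l) {x : V}
    (hx : ChainReaches l x) : l.length ≤ G.rank x := by
  refine le_csSup ⟨Nat.card G.Subgraph, ?_⟩ ⟨l, hl, hx, rfl⟩
  rintro k ⟨l, hl, -, rfl⟩
  exact hl.length_le

theorem rank_mono {x y : V} (h : G.Reach x y) : G.rank x ≤ G.rank y := by
  obtain ⟨l, hl, hx, hlen⟩ := exists_length_eq_rank (G := G) x
  rw [← hlen]
  refine hl.length_le_rank fun C hC => ?_
  obtain ⟨z, hz, hzx⟩ := hx C hC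
  exact ⟨z, hz, hzx.trans h⟩

theorem rank_pos {C : G.Subgraph} (hC : C.IsCycle) {x : V} (hx : x ∈ C.verts) : 0 < G.rank x := by
  refine Nat.lt_of_lt_of_le Nat.zero_lt_one (IsCycleChain.length_le_rank (l := [C]) ?_ ?_)
  · simpa [IsCycleChain] using hC
  · rintro D hD
    obtain rfl : C = D := by simpa using hD
    exact ⟨x, hx, .refl x⟩

/-- A longest chain that reaches the source of e can be extended by C. If C occurred in it already,
e would lie on a closed path through C and hence in C. -/
theorem CyclesDisjoint.rank_lt (H : G.CyclesDisjoint) {C : G.Subgraph} (hC : C.IsCycle) {e : E}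
    (hr : G.r e ∈ C.verts) (he : e ∉ C.edges) : G.rank (G.s e) < G.rank (G.r e) := by
  obtain ⟨l, hl, hx, hlen⟩ := exists_length_eq_rank (G := G) (G.s e)
  have hCl : C ∉ l := fun h => by
    obtain ⟨y, hy, hye⟩ := hl.reach_of_mem hx h
    exact he (H.mem_edges_of_reach hC hy hye (hC.reach hr hy))
  have : (l ++ [C]).length ≤ G.rank (G.r e) := by
    refine IsCycleChain.length_le_rank ⟨?_, ?_, ?_⟩ ?_
    · simp only [List.mem_append, List.mem_singleton]
      rintro D (hD | rfl)
      exacts [hl.1 D hD, hC]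
    · rw [List.nodup_append_comm, List.singleton_append, List.nodup_cons]
      exact ⟨hCl, hl.2.1⟩
    · refine List.isChain_append.2 ⟨hl.2.2, by simp, ?_⟩
      intro D hD D' hD'
      obtain rfl : C = D' := by simpa using hD'
      obtain ⟨y, hy, hye⟩ := hx D hD
      obtain ⟨p, hp⟩ := hye.trans (reach_edge e)
      exact ⟨y, hy, _, hr, p, hp⟩
    · intro D hD
      obtain rfl : C = D := by simpa using hD
      exact ⟨_, hr, .refl _⟩
  rw [List.length_append, List.length_singleton, hlen] at this
  exact this

end

variable (G) in
/-- The number of vertices from which `x` can be reached. -/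
noncomputable def ancestorCount (x : V) : ℕ := {y | G.Reach y x}.ncard

variable [Finite V]

theorem ancestorCount_mono {x y : V} (h : G.Reach x y) :
    G.ancestorCount x ≤ G.ancestorCount y :=
  Set.ncard_le_ncard (fun _ hz => .trans hz h) (Set.toFinite _)

theorem ancestorCount_lt {x y : V} (h : G.Reach x y) (h' : ¬ G.Reach y x) :
    G.ancestorCount x < G.ancestorCount y :=
  Set.ncard_lt_ncard ⟨fun _ hz => .trans hz h, fun hs => h' (hs (Reach.refl y))⟩ (Set.toFinite _)

theorem ancestorCount_le (x : V) : G.ancestorCount x ≤ Nat.card V := by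
  rw [← Set.ncard_univ]
  exact Set.ncard_le_ncard (Set.subset_univ _) (Set.toFinite _)

end DirectedGraph

/-! ## Upper bounds for the number of paths and normal triples -/

namespace DirectedGraph

variable {V : Type u} {E : Type v} {G : DirectedGraph V E}

variable (G) in
/-- The reversed paths to `x` with at most `n` edges whose last edge, if any, lies in `S`. -/
def copathsIn (S : Set E) (x : V) (n : ℕ) : Set (List E) :=
  {q | G.IsCopath x q ∧ q.length ≤ n ∧ ∀ e, q.head? = some e → e ∈ S}

variable (G) in
/-- The reversed paths to `x` with at most `n` edges. -/
abbrev copaths (x : V) (n : ℕ) : Set (List E) := G.copathsIn Set.univ x n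

theorem mem_copaths {x : V} {n : ℕ} {q : List E} :
    q ∈ G.copaths x n ↔ G.IsCopath x q ∧ q.length ≤ n := by
  simp [copathsIn]

theorem finite_copathsIn [Finite E] (S : Set E) (x : V) (n : ℕ) : (G.copathsIn S x n).Finite :=
  (List.finite_length_le E n).subset fun _ h => h.2.1

theorem copathsIn_subset [Fintype E] (S : Set E) (x : V) (n : ℕ) [DecidablePred (· ∈ S)]
    [DecidableEq V] : G.copathsIn S x n ⊆ {[]} ∪
      ⋃ e ∈ Finset.univ.filter fun e => G.r e = x ∧ e ∈ S, (e :: ·) '' G.copaths (G.s e) n := by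
  rintro (_ | ⟨e, q⟩) ⟨h₁, h₂, h₃⟩
  · simp
  · refine .inr (Set.mem_biUnion (x := e) (by simpa using ⟨h₁.1, h₃ e rfl⟩) ⟨q, ?_, rfl⟩)
    exact mem_copaths.2 ⟨h₁.2, (Nat.le_succ _).trans h₂⟩

/-- The last edge is peeled off; the empty path accounts for the summand 1. -/
theorem ncard_copathsIn_le [Fintype E] (S : Set E) (x : V) (n B : ℕ)
    (hB : ∀ e ∈ S, G.r e = x → (G.copaths (G.s e) n).ncard ≤ B) :
    (G.copathsIn S x n).ncard ≤ 1 + Fintype.card E * B := by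
  classical
  have hfin : ∀ e : E, ((e :: ·) '' G.copaths (G.s e) n).Finite := fun e =>
    (finite_copathsIn _ _ _).image _
  refine (Set.ncard_le_ncard (copathsIn_subset S x n) ?_).trans
    ((Set.ncard_union_le _ _).trans ?_)
  · exact (Set.finite_singleton _).union (Set.Finite.biUnion (Finset.finite_toSet _)
      fun e _ => hfin e)
  · rw [Set.ncard_singleton]
    refine Nat.add_le_add_left ((Finset.set_ncard_biUnion_le _ _).trans ?_) 1
    refine (Finset.sum_le_card_nsmul _ _ B fun e he => ?_).trans
      (Nat.mul_le_mul_right B (Finset.card_le_univ _))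
    rw [Finset.mem_filter] at he
    exact (Set.ncard_image_le (finite_copathsIn _ _ _)).trans (hB e he.2.2 he.2.1)

/-- The count by last edges has the form 1 + M B; the spare factor M + 1 that a < b provides absorbs
both the 1 and the M. -/
theorem one_add_mul_pow_le {M a b n j : ℕ} (h : a < b) :
    1 + M * ((M + 1) ^ a * (n + 1) ^ j) ≤ (M + 1) ^ b * (n + 1) ^ j := by
  have h1 : 1 ≤ (M + 1) ^ a * (n + 1) ^ j := Nat.one_le_iff_ne_zero.2 (by positivity)
  calc 1 + M * ((M + 1) ^ a * (n + 1) ^ j)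
      ≤ (M + 1) ^ a * (n + 1) ^ j + M * ((M + 1) ^ a * (n + 1) ^ j) := Nat.add_le_add_right h1 _
    _ = (M + 1) ^ (a + 1) * (n + 1) ^ j := by ring
    _ ≤ _ := Nat.mul_le_mul_right _ (Nat.pow_le_pow_right (Nat.succ_pos _) h)

variable (G) in
/-- A bound for the number of paths to `x`. -/
def PathBound [Fintype E] (x : V) : Prop :=
  ∀ n, (G.copaths x n).ncard ≤ (Fintype.card E + 1) ^ G.ancestorCount x * (n + 1) ^ G.rank x

theorem CyclesDisjoint.not_reach (H : G.CyclesDisjoint) {C : G.Subgraph} (hC : C.IsCycle) {e : E}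
    (hr : G.r e ∈ C.verts) (he : e ∉ C.edges) : ¬ G.Reach (G.r e) (G.s e) := fun h =>
  he (H.mem_edges_of_reach hC hr h (.refl _))

/-- Since e is the only edge of C into its range, a path to that vertex whose last edge lies in C
ends with e, and deleting e shortens it by one. -/
theorem copaths_succ_subset {C : G.Subgraph} (hC : C.IsCycle) {e : E} (he : e ∈ C.edges) (n : ℕ) :
    G.copaths (G.r e) (n + 1) ⊆
      G.copathsIn C.edgesᶜ (G.r e) (n + 1) ∪ (e :: ·) '' G.copaths (G.s e) n := by
  rintro q hq
  rw [mem_copaths] at hq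
  by_cases h : ∀ f, q.head? = some f → f ∈ C.edgesᶜ
  · exact .inl ⟨hq.1, hq.2, h⟩
  · push Not at h
    obtain ⟨f, hf, hfC⟩ := h
    cases q with
    | nil => simp at hf
    | cons g q =>
      obtain rfl : g = f := by simpa using hf
      obtain rfl : g = e := hC.r_injOn (not_not.1 hfC) he hq.1.1
      exact .inr ⟨q, mem_copaths.2 ⟨hq.1.2, by simpa using hq.2⟩, rfl⟩

theorem ncard_normalTriples_le_sum [Fintype V] (n B : ℕ)
    (hB : ∀ x, {t ∈ G.normalTriples n | t.2.1 = x}.ncard ≤ B) :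
    (G.normalTriples n).ncard ≤ Fintype.card V * B := by
  have : G.normalTriples n = ⋃ x ∈ (Finset.univ : Finset V), {t ∈ G.normalTriples n | t.2.1 = x} := by
    ext t; simp
  rw [this]
  exact (Finset.set_ncard_biUnion_le _ _).trans (Finset.sum_le_card_nsmul _ _ B fun x _ => hB x)

theorem mem_copaths_of_normal {p q : List E} {x : V} {n : ℕ}
    (h : (p, x, q) ∈ G.normalTriples n) : p.reverse ∈ G.copaths x n ∧ q ∈ G.copaths x n := by
  have h₂ : p.length + q.length ≤ n := h.2
  exact ⟨mem_copaths.2 ⟨isCopath_reverse_iff.2 h.1.1, by rw [List.length_reverse]; omega⟩,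
    mem_copaths.2 ⟨h.1.2.1, by omega⟩⟩

theorem ncard_fiber_le {x : V} {n : ℕ} {S : Set (List E × List E)} (hS : S.Finite)
    (h : ∀ p q, (p, x, q) ∈ G.normalTriples n → (p.reverse, q) ∈ S) :
    {t ∈ G.normalTriples n | t.2.1 = x}.ncard ≤ S.ncard := by
  refine Set.ncard_le_ncard_of_injOn (fun t => (t.1.reverse, t.2.2)) ?_ ?_ hS
  · rintro ⟨p, y, q⟩ ⟨ht, rfl⟩
    exact h p q ht
  · rintro ⟨p, y, q⟩ ⟨-, rfl⟩ ⟨p', y', q'⟩ ⟨-, rfl⟩ h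
    simp only [Prod.mk.injEq, List.reverse_inj] at h
    simp [h.1, h.2]

/-- A path that starts in a cycle without exit ends in it. -/
theorem mem_verts_of_not_hasExit {C : G.Subgraph} (hC : ¬ C.HasExit) {x y : V} (hx : x ∈ C.verts)
    (h : G.Reach x y) : y ∈ C.verts := by
  obtain ⟨p, hp⟩ := h
  induction hp with
  | nil => exact hx
  | cons e _ ih =>
    refine ih (C.r_mem e ?_)
    by_contra he
    exact hC ⟨e, hx, he⟩

/-- Without an exit, each vertex of C emits only its edge in C, so the choice of the special edge is
forced. -/
theorem special_eq_of_not_hasExit {C : G.Subgraph} (hC : C.IsCycle) (hex : ¬ C.HasExit) {e : E}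
    (he : e ∈ C.edges) : G.special e = e := by
  refine hC.s_injOn ?_ he (s_special e)
  by_contra h
  exact hex ⟨_, by rw [s_special]; exact C.s_mem e he, h⟩

variable [Finite V] [Fintype E]

/-- An edge entering C starts at a vertex of smaller rank and with fewer ancestors. The former
lowers the exponent by one, the latter leaves a factor for the choice of the edge. -/
theorem CyclesDisjoint.ncard_entry_le (H : G.CyclesDisjoint) {C : G.Subgraph} (hC : C.IsCycle)
    {x : V} (hx : x ∈ C.verts) (hB : ∀ e ∉ C.edges, G.r e = x → G.PathBound (G.s e)) (n : ℕ) :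
    (G.copathsIn C.edgesᶜ x n).ncard ≤
      (Fintype.card E + 1) ^ G.ancestorCount x * (n + 1) ^ (G.rank x - 1) := by
  have hpos : 0 < G.ancestorCount x :=
    (Set.ncard_pos (Set.toFinite _)).2 ⟨x, Reach.refl x⟩
  refine (ncard_copathsIn_le C.edgesᶜ x n ((Fintype.card E + 1) ^ (G.ancestorCount x - 1) *
    (n + 1) ^ (G.rank x - 1)) fun e he hr => ?_).trans (one_add_mul_pow_le (by omega))
  subst hr
  have h₁ := H.rank_lt hC hx he
  have h₂ := ancestorCount_lt (reach_edge e) (H.not_reach hC hx he)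
  refine (hB e he rfl n).trans (Nat.mul_le_mul (Nat.pow_le_pow_right (Nat.succ_pos _) (by omega))
    (Nat.pow_le_pow_right (Nat.succ_pos _) (by omega)))

/-- The number of paths to `x` is bounded by a polynomial whose degree is the rank of `x`. -/
theorem CyclesDisjoint.pathBound (H : G.CyclesDisjoint) (x : V) : G.PathBound x := by
  induction hk : G.ancestorCount x using Nat.strong_induction_on generalizing x with
  | _ k ih =>
    by_cases hcyc : ∃ C : G.Subgraph, C.IsCycle ∧ x ∈ C.verts
    · obtain ⟨C, hC, hx⟩ := hcyc
      -- Ancestors and rank are constant along a cycle, so all vertices of C are treated together.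
      have hanc : ∀ z ∈ C.verts, G.ancestorCount z = k := fun z hz => hk ▸
        le_antisymm (ancestorCount_mono (hC.reach hz hx)) (ancestorCount_mono (hC.reach hx hz))
      have hrank : ∀ z ∈ C.verts, G.rank z = G.rank x := fun z hz =>
        le_antisymm (rank_mono (hC.reach hz hx)) (rank_mono (hC.reach hx hz))
      set ρ := G.rank x with hρ
      set M := (Fintype.card E + 1) ^ k
      have hent : ∀ z ∈ C.verts, ∀ n,
          (G.copathsIn C.edgesᶜ z n).ncard ≤ M * (n + 1) ^ (ρ - 1) := by
        intro z hz n
        have := H.ncard_entry_le hC hz (fun e he hr => ?_) n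
        · rwa [hanc z hz, hrank z hz] at this
        · subst hr
          refine ih _ ?_ _ rfl
          rw [← hanc _ hz]
          exact ancestorCount_lt (reach_edge e) (H.not_reach hC hz he)
      -- A path to z ends outside C or with the unique edge of C into z. Removing that edge moves
      -- one step back along C, so each unit of length costs one more copy of the entry bound.
      have key : ∀ n, ∀ z ∈ C.verts,
          (G.copaths z n).ncard ≤ (n + 1) * (M * (n + 1) ^ (ρ - 1)) := by
        intro n
        induction n with
        | zero =>
          intro z hz
          rw [zero_add, one_mul]
          refine le_trans (Set.ncard_le_ncard ?_ (finite_copathsIn _ _ _)) (hent z hz 0)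
          rintro (_ | ⟨e, q⟩) h
          · exact ⟨trivial, le_rfl, by simp⟩
          · simp [mem_copaths] at h
        | succ n ihn =>
          intro z hz
          by_cases he : ∃ e ∈ C.edges, G.r e = z
          · obtain ⟨e, he, rfl⟩ := he
            have h₁ := ihn (G.s e) (C.s_mem e he)
            have h₂ := hent _ hz (n + 1)
            have h₃ : (G.copaths (G.r e) (n + 1)).ncard ≤
                (G.copathsIn C.edgesᶜ (G.r e) (n + 1)).ncard + (G.copaths (G.s e) n).ncard :=
              (Set.ncard_le_ncard (copaths_succ_subset hC he n) ((finite_copathsIn _ _ _).union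
                ((finite_copathsIn _ _ _).image _))).trans ((Set.ncard_union_le _ _).trans
                (Nat.add_le_add_left (Set.ncard_image_le (finite_copathsIn _ _ _)) _))
            have h₄ : M * (n + 1) ^ (ρ - 1) ≤ M * (n + 1 + 1) ^ (ρ - 1) :=
              Nat.mul_le_mul_left _ (Nat.pow_le_pow_left (Nat.le_succ _) _)
            calc _ ≤ _ := h₃
              _ ≤ M * (n + 1 + 1) ^ (ρ - 1) + (n + 1) * (M * (n + 1 + 1) ^ (ρ - 1)) :=
                Nat.add_le_add h₂ (h₁.trans (Nat.mul_le_mul_left _ h₄))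
              _ = _ := by ring
          · refine le_trans (Set.ncard_le_ncard ?_ (finite_copathsIn _ _ _))
              ((hent z hz (n + 1)).trans (Nat.le_mul_of_pos_left _ (Nat.succ_pos _)))
            intro q hq
            rw [mem_copaths] at hq
            refine ⟨hq.1, hq.2, fun e heq heC => he ⟨e, heC, ?_⟩⟩
            cases q with
            | nil => simp at heq
            | cons f q =>
              obtain rfl : f = e := by simpa using heq
              exact hq.1.1
      intro n
      have hpos : 0 < ρ := rank_pos hC hx
      have := key n x hx
      rw [hk]
      calc _ ≤ _ := this
        _ = M * ((n + 1) ^ (ρ - 1) * (n + 1)) := by ring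
        _ = _ := by rw [← pow_succ, Nat.sub_add_cancel hpos]
    -- Off the cycles a predecessor has strictly fewer ancestors but possibly the same rank, so the
    -- constant grows and the exponent does not.
    · have hlt : ∀ e, G.r e = x → G.ancestorCount (G.s e) < k := by
        rintro e rfl
        rw [← hk]
        refine ancestorCount_lt (reach_edge e) fun ⟨p, hp⟩ => hcyc ?_
        exact exists_isCycle_of_isPath (hp.append (isPath_singleton e)) (by simp)
      have hpos : 0 < k := hk ▸ (Set.ncard_pos (Set.toFinite _)).2 ⟨x, Reach.refl x⟩
      intro n
      rw [hk]
      refine (ncard_copathsIn_le Set.univ x n ((Fintype.card E + 1) ^ (k - 1) *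
        (n + 1) ^ G.rank x) fun e _ hr => ?_).trans (one_add_mul_pow_le (by omega))
      refine (ih _ (hlt e hr) _ rfl n).trans (Nat.mul_le_mul
        (Nat.pow_le_pow_right (Nat.succ_pos _) (Nat.le_sub_one_of_lt (hlt e hr)))
        (Nat.pow_le_pow_right (Nat.succ_pos _) (hr ▸ rank_mono (reach_edge e))))

/-- The number of normal triples is bounded by a polynomial in the number of edges. -/
theorem CyclesDisjoint.ncard_normalTriples_le (H : G.CyclesDisjoint) {d₁ d₂ : ℕ}
    (h₁ : G.IsMaxChainLength d₁) (h₂ : G.IsMaxChainWithExitLength d₂) :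
    ∃ c, ∀ n, (G.normalTriples n).ncard ≤ c * (n + 1) ^ max (2 * d₁ - 1) (2 * d₂) := by
  cases nonempty_fintype V
  set M := (Fintype.card E + 1) ^ Nat.card V with hM
  have hMpos : 0 < M := by positivity
  have hanc : ∀ x : V, (Fintype.card E + 1) ^ G.ancestorCount x ≤ M := fun x =>
    Nat.pow_le_pow_right (Nat.succ_pos _) (ancestorCount_le x)
  refine ⟨Fintype.card V * (2 * (M * M)), fun n => ?_⟩
  rw [mul_assoc]
  refine ncard_normalTriples_le_sum n _ fun x => ?_
  have hbound : (G.copaths x n).ncard ≤ M * (n + 1) ^ G.rank x :=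
    (H.pathBound x n).trans (Nat.mul_le_mul_right _ (hanc x))
  obtain ⟨l, hl, hlx, hlen⟩ := exists_length_eq_rank (G := G) x
  -- For rank at most d₂, counting all pairs (p, q) is good enough.
  by_cases hrank : G.rank x ≤ d₂
  · refine (ncard_fiber_le (S := G.copaths x n ×ˢ G.copaths x n)
      ((finite_copathsIn _ _ _).prod (finite_copathsIn _ _ _))
      fun p q h => mem_copaths_of_normal h).trans ?_
    rw [Set.ncard_prod]
    calc _ ≤ _ := Nat.mul_le_mul hbound hbound
      _ = M * M * (n + 1) ^ (2 * G.rank x) := by ring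
      _ ≤ 2 * (M * M) * (n + 1) ^ max (2 * d₁ - 1) (2 * d₂) :=
        Nat.mul_le_mul (Nat.le_mul_of_pos_left _ Nat.two_pos)
          (Nat.pow_le_pow_right (Nat.succ_pos _) (le_max_of_le_right (by omega)))
  -- The chain is longer than d₂, so its last cycle C has no exit and contains x. Its edges are
  -- special and only one of them ends at x, so by normality p and q do not both end in C; this
  -- saves one power of n.
  · have hne : l ≠ [] := by rintro rfl; simp at hlen; omega
    have hlast : l.getLast? = some (l.getLast hne) := List.getLast?_eq_getLast_of_ne_nil hne
    set C := l.getLast hne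
    have hC : C.IsCycle := hl.1 _ (List.getLast_mem hne)
    have hex : ¬ C.HasExit := fun h => by
      refine hrank (hlen ▸ h₂.2 ⟨l, hl, fun D hD => ?_, rfl⟩)
      obtain rfl : C = D := by simpa [hlast] using hD
      exact h
    obtain ⟨y, hy, hyx⟩ := hlx C hlast
    have hx : x ∈ C.verts := mem_verts_of_not_hasExit hex hy hyx
    have hent : (G.copathsIn C.edgesᶜ x n).ncard ≤ M * (n + 1) ^ (G.rank x - 1) :=
      (H.ncard_entry_le hC hx (fun e _ _ => H.pathBound _) n).trans
        (Nat.mul_le_mul_right _ (hanc x))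
    have hd₁ : G.rank x ≤ d₁ := hlen ▸ h₁.2 ⟨l, hl, rfl⟩
    have hpos : 0 < G.rank x := rank_pos hC hx
    refine (ncard_fiber_le (S := G.copathsIn C.edgesᶜ x n ×ˢ G.copaths x n ∪
      G.copaths x n ×ˢ G.copathsIn C.edgesᶜ x n)
      (((finite_copathsIn _ _ _).prod (finite_copathsIn _ _ _)).union
        ((finite_copathsIn _ _ _).prod (finite_copathsIn _ _ _))) fun p q h => ?_).trans ?_
    · obtain ⟨hp, hq⟩ := mem_copaths_of_normal h
      by_cases hp' : ∀ e, p.reverse.head? = some e → e ∈ C.edgesᶜ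
      · exact .inl ⟨⟨hp.1, hp.2.1, hp'⟩, hq⟩
      · refine .inr ⟨hp, hq.1, hq.2.1, fun f hf hfC => ?_⟩
        push Not at hp'
        obtain ⟨e, he, heC⟩ := hp'
        have hr : ∀ {q : List E} {f : E}, G.IsCopath x q → q.head? = some f → G.r f = x := by
          rintro (_ | ⟨g, q⟩) f hq hf
          · simp at hf
          · obtain rfl : g = f := by simpa using hf
            exact hq.1
        obtain rfl : e = f :=
          hC.r_injOn (not_not.1 heC) hfC ((hr hp.1 he).trans (hr hq.1 hf).symm)
        rw [List.head?_reverse] at he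
        exact h.1.2.2 e he hf (special_eq_of_not_hasExit hC hex hfC)
    · refine (Set.ncard_union_le _ _).trans ?_
      rw [Set.ncard_prod, Set.ncard_prod]
      calc _ ≤ _ := Nat.add_le_add (Nat.mul_le_mul hent hbound) (Nat.mul_le_mul hbound hent)
        _ = 2 * (M * M) * (n + 1) ^ (G.rank x - 1 + G.rank x) := by ring
        _ ≤ _ := Nat.mul_le_mul_left _
          (Nat.pow_le_pow_right (Nat.succ_pos _) (le_max_of_le_left (by omega)))

end DirectedGraph

/-! ## Lower bounds for the number of normal triples -/

namespace DirectedGraph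

variable {V : Type u} {E : Type v} {G : DirectedGraph V E}

theorem IsPathTo.append {p q : List E} {x y : V} (hp : G.IsPathTo p x) (hq : G.IsPath x q y) :
    G.IsPathTo (p ++ q) y :=
  (hp.isPath.append hq).isPathTo

theorem isPath_flatten_replicate {c : List E} {x : V} (hc : G.IsPath x c x) (k : ℕ) :
    G.IsPath x (List.replicate k c).flatten x := by
  induction k with
  | zero => exact .nil x
  | succ k ih => rw [List.replicate_succ, List.flatten_cons]; exact hc.append ih

/-- Appending powers of a closed path in `C` to paths that do not end in `C`. -/
theorem append_replicate_injOn {C : Set E} {c : List E} (hc : c ≠ []) (hcC : ∀ e ∈ c, e ∈ C)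
    {Q : Set (List E)} (hQ : ∀ q ∈ Q, ∀ e, q.getLast? = some e → e ∉ C) (N : Set ℕ) :
    Set.InjOn (fun t : List E × ℕ => t.1 ++ (List.replicate t.2 c).flatten) (Q ×ˢ N) := by
  -- After the common powers of c are cancelled, any surplus power would force q to end with an edge
  -- of C.
  have key : ∀ q ∈ Q, ∀ q' : List E, ∀ a d : ℕ, q ++ (List.replicate a c).flatten =
      q' ++ (List.replicate (d + a) c).flatten → d = 0 ∧ q = q' := by
    intro q hq q' a d h
    rw [List.replicate_add, List.flatten_append, ← List.append_assoc,
      List.append_cancel_right_eq] at h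
    cases d with
    | zero => simpa using h
    | succ d =>
      rw [List.replicate_succ', List.flatten_append, List.flatten_singleton,
        ← List.append_assoc] at h
      have hlast : q.getLast? = some (c.getLast hc) := by
        rw [h, List.getLast?_append_of_ne_nil _ hc, List.getLast?_eq_getLast_of_ne_nil hc]
      exact absurd (hcC _ (List.getLast_mem hc)) (hQ q hq _ hlast)
  rintro ⟨q, a⟩ ⟨hq, -⟩ ⟨q', a'⟩ ⟨hq', -⟩ h
  rcases le_total a a' with haa | haa
  · obtain ⟨d, rfl⟩ := Nat.exists_eq_add_of_le' haa
    obtain ⟨rfl, rfl⟩ := key q hq q' a d h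
    simp
  · obtain ⟨d, rfl⟩ := Nat.exists_eq_add_of_le' haa
    obtain ⟨rfl, rfl⟩ := key q' hq' q a' d h.symm
    simp

/-- A path into `C` from outside has an initial part that ends with the first edge into `C`. -/
theorem IsPath.exists_entry {C : G.Subgraph} {x y : V} {p : List E} (h : G.IsPath x p y)
    (hx : x ∉ C.verts) (hy : y ∈ C.verts) :
    ∃ p' f, G.IsPath x (p' ++ [f]) (G.r f) ∧ G.r f ∈ C.verts ∧ f ∉ C.edges := by
  induction h with
  | nil => exact absurd hy hx
  | cons e _ ih =>
    by_cases he : G.r e ∈ C.verts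
    · exact ⟨[], e, isPath_singleton e, he, fun h => hx (C.s_mem e h)⟩
    · obtain ⟨p', f, hp, hf⟩ := ih he hy
      exact ⟨e :: p', f, .cons e hp, hf⟩

/-- There are at least `N ^ k` paths to `x`, of length bounded by a multiple of `N + 1`, all with
last edge in `S`, if any. -/
def ManyPaths (G : DirectedGraph V E) (S : Set E) (x : V) (k : ℕ) : Prop :=
  ∃ M, ∀ N : ℕ, ∃ Q : Finset (List E), N ^ k ≤ Q.card ∧
    ∀ q ∈ Q, G.IsPathTo q x ∧ q.length ≤ M * (N + 1) ∧ ∀ e, q.getLast? = some e → e ∈ S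

/-- Appending a fixed tail is injective and adds a constant to the length; its last edge f brings
the new paths into the class T. -/
theorem ManyPaths.append {S T : Set E} {x y : V} {k : ℕ} (h : G.ManyPaths S x k) {w : List E}
    {f : E} (hw : G.IsPath x (w ++ [f]) y) (hf : f ∈ T) : G.ManyPaths T y k := by
  classical
  obtain ⟨M, hM⟩ := h
  refine ⟨M + (w ++ [f]).length, fun N => ?_⟩
  obtain ⟨Q, hcard, hQ⟩ := hM N
  refine ⟨Q.image (· ++ (w ++ [f])), ?_, ?_⟩
  · rwa [Finset.card_image_of_injective _ (List.append_left_injective _)]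
  · simp only [Finset.mem_image]
    rintro _ ⟨q, hq, rfl⟩
    refine ⟨(hQ q hq).1.append hw, ?_, fun e he => ?_⟩
    · rw [List.length_append, add_mul]
      exact Nat.add_le_add (hQ q hq).2.1 (Nat.le_mul_of_pos_right _ (Nat.succ_pos _))
    · obtain rfl : f = e := by simpa [← List.append_assoc] using he
      exact hf

/-- Between 1 and N turns around C multiply the count by N. The number of turns can be read off
because the old paths do not end in C; zero turns are excluded so that the new ones do. -/
theorem ManyPaths.cycle {C : G.Subgraph} (hC : C.IsCycle) {x : V} (hx : x ∈ C.verts) {k : ℕ}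
    (h : G.ManyPaths C.edgesᶜ x k) : G.ManyPaths C.edges x (k + 1) := by
  classical
  obtain ⟨M, hM⟩ := h
  obtain ⟨c, hne, hc, -, rfl⟩ := hC.exists_isPath hx
  refine ⟨M + c.length, fun N => ?_⟩
  obtain ⟨Q, hcard, hQ⟩ := hM N
  refine ⟨(Q ×ˢ Finset.Icc 1 N).image fun t => t.1 ++ (List.replicate t.2 c).flatten, ?_, ?_⟩
  · rw [Finset.card_image_of_injOn, Finset.card_product, Nat.card_Icc, Nat.add_sub_cancel, pow_succ]
    · exact Nat.mul_le_mul_right _ hcard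
    · rw [Finset.coe_product]
      exact append_replicate_injOn hne (C := (G.subgraphOf c).edges) (fun e he => he)
        (fun q hq => (hQ q hq).2.2) _
  · simp only [Finset.mem_image, Finset.mem_product, Finset.mem_Icc]
    rintro _ ⟨⟨q, a⟩, ⟨hq, ha, haN⟩, rfl⟩
    refine ⟨(hQ q hq).1.append (isPath_flatten_replicate hc a), ?_, fun e he => ?_⟩
    · have h₁ : a * c.length ≤ (N + 1) * c.length := Nat.mul_le_mul_right _ (by omega)
      have h₂ := (hQ q hq).2.1
      simp only [List.length_append, List.length_flatten, List.map_replicate, List.sum_replicate,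
        smul_eq_mul]
      rw [add_mul, mul_comm c.length]
      omega
    · obtain ⟨a, rfl⟩ := Nat.exists_eq_add_of_le' ha
      rw [List.replicate_succ', List.flatten_append, List.flatten_singleton, ← List.append_assoc,
        List.getLast?_append_of_ne_nil _ hne] at he
      exact List.mem_of_getLast? he

theorem manyPaths_zero (S : Set E) (x : V) : G.ManyPaths S x 0 :=
  ⟨0, fun N => ⟨{[]}, by simp, by simp [IsPathTo]⟩⟩

/-- Along a chain of `k + 1` cycles there are many paths that enter the last cycle. -/
theorem CyclesDisjoint.manyPaths (H : G.CyclesDisjoint) {l : List G.Subgraph} {C : G.Subgraph}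
    (hl : IsCycleChain (l ++ [C])) : ∃ x ∈ C.verts, G.ManyPaths C.edgesᶜ x l.length := by
  induction l using List.reverseRecOn generalizing C with
  | nil =>
    obtain ⟨p, ⟨hp, -⟩, rfl⟩ := hl.1 C (by simp)
    obtain ⟨e, he⟩ := List.exists_mem_of_ne_nil p hp
    exact ⟨G.s e, ⟨e, he, .inl rfl⟩, manyPaths_zero _ _⟩
  | append_singleton l D ih =>
    obtain ⟨h₁, h₂, h₃⟩ := hl
    have hD : D.IsCycle := h₁ D (by simp)
    have hC : C.IsCycle := h₁ C (by simp)
    obtain ⟨x, hx, hmany⟩ := ih ⟨fun D' hD' => h₁ D' (List.mem_append_left _ hD'),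
      (List.nodup_append.1 h₂).1, (List.isChain_append.1 h₃).1⟩
    have hne : D ≠ C := by
      rintro rfl
      simp [List.nodup_append] at h₂
    obtain ⟨a, ha, b, hb, p, hp⟩ : D.Reaches C :=
      (List.isChain_append.1 h₃).2.2 D (by simp) C (by simp)
    obtain ⟨q, hq⟩ := hD.reach hx ha
    -- By disjointness x lies outside C. Cutting the path at its first edge into C, which is not an
    -- edge of C, allows the next winding step.
    obtain ⟨w, f, hw, hr, hf⟩ := (hq.append hp).exists_entry
      (fun hxC => hne (H.eq hD hC hx hxC)) hb
    refine ⟨G.r f, hr, ?_⟩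
    rw [List.length_append, List.length_singleton]
    exact (hmany.cycle hD hx).append hw hf

theorem ncard_normalTriples_ge [Finite V] [Finite E] {P Q : Finset (List E)} {x : V} {n : ℕ}
    (h : ∀ p ∈ P, ∀ q ∈ Q, (p, x, q.reverse) ∈ G.normalTriples n) :
    P.card * Q.card ≤ (G.normalTriples n).ncard := by
  rw [← Finset.card_product, ← Set.ncard_coe_finset]
  refine Set.ncard_le_ncard_of_injOn (fun t => (t.1, x, t.2.reverse)) ?_ ?_
    (G.finite_normalTriples n)
  · rintro ⟨p, q⟩ ht
    rw [Finset.mem_coe, Finset.mem_product] at ht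
    exact h p ht.1 q ht.2
  · rintro ⟨p, q⟩ - ⟨p', q'⟩ - h
    simpa using h

/-- The condition on S and T makes every pair (p, q) normal, so the two counts multiply. -/
theorem ManyPaths.ncard_ge [Finite V] [Finite E] {S T : Set E} {x : V} {j k : ℕ}
    (h₁ : G.ManyPaths S x j) (h₂ : G.ManyPaths T x k)
    (hST : ∀ e ∈ S, e ∈ T → G.special e ≠ e) :
    ∃ M, ∀ N, N ^ (j + k) ≤ (G.normalTriples (M * (N + 1))).ncard := by
  obtain ⟨M₁, hM₁⟩ := h₁
  obtain ⟨M₂, hM₂⟩ := h₂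
  refine ⟨M₁ + M₂, fun N => ?_⟩
  obtain ⟨P, hPc, hP⟩ := hM₁ N
  obtain ⟨Q, hQc, hQ⟩ := hM₂ N
  rw [pow_add]
  refine (Nat.mul_le_mul hPc hQc).trans (ncard_normalTriples_ge (x := x) fun p hp q hq => ?_)
  obtain ⟨hp₁, hp₂, hp₃⟩ := hP p hp
  obtain ⟨hq₁, hq₂, hq₃⟩ := hQ q hq
  refine ⟨⟨hp₁, isCopath_reverse_iff.2 hq₁, fun e he he' => ?_⟩, ?_⟩
  · exact hST e (hp₃ e he) (hq₃ e (by simpa using he'))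
  · simp only [tripleLength, List.length_reverse, add_mul]
    exact Nat.add_le_add hp₂ hq₂

/-- The number of normal triples is bounded from below by a polynomial in the number of edges. -/
theorem CyclesDisjoint.le_ncard_normalTriples [Finite V] [Finite E] [Nonempty V]
    (H : G.CyclesDisjoint) {d₁ d₂ : ℕ}
    (h₁ : G.IsMaxChainLength d₁) (h₂ : G.IsMaxChainWithExitLength d₂) :
    ∃ M, ∀ N, N ^ max (2 * d₁ - 1) (2 * d₂) ≤ (G.normalTriples (M * (N + 1))).ncard := by
  rcases max_choice (2 * d₁ - 1) (2 * d₂) with h | h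
  all_goals
    -- Exponent 0 needs just one normal triple; excluding it makes the chains below nonempty.
    by_cases h0 : max (2 * d₁ - 1) (2 * d₂) = 0
    · refine ⟨0, fun N => ?_⟩
      obtain ⟨x⟩ := ‹Nonempty V›
      rw [h0, pow_zero, Nat.one_le_iff_ne_zero, ← Nat.pos_iff_ne_zero,
        Set.ncard_pos (G.finite_normalTriples _)]
      exact ⟨([], x, []), .nil trivial, by simp [tripleLength]⟩
    rw [h] at h0 ⊢
  · obtain ⟨l, hl, hlen⟩ := h₁.1
    obtain rfl | ⟨l, C, rfl⟩ := l.eq_nil_or_concat'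
    · simp at hlen; omega
    · obtain ⟨x, hx, hmany⟩ := H.manyPaths hl
      -- Here p winds around C and q does not end in C, so their last edges cannot agree.
      have := (hmany.cycle (hl.1 C (by simp)) hx).ncard_ge hmany fun e he he' => absurd he he'
      rw [List.length_append, List.length_singleton] at hlen
      rwa [show 2 * d₁ - 1 = l.length + 1 + l.length by omega]
  · obtain ⟨l, hl, hex, hlen⟩ := h₂.1
    obtain rfl | ⟨l, C, rfl⟩ := l.eq_nil_or_concat'
    · simp at hlen; omega
    · obtain ⟨x, hx, hmany⟩ := H.manyPaths hl
      have hC : C.IsCycle := hl.1 C (by simp)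
      obtain ⟨f, hfC, hf⟩ := hex C (by simp)
      -- The exit f and the edge of C with the same source are distinct, so one of them is not
      -- special. If both p and q end with it, every pair is normal.
      obtain ⟨g, hs, hg⟩ : ∃ g, G.s g = G.s f ∧ G.special g ≠ g := by
        by_cases hsp : G.special f = f
        · obtain ⟨p, hp, hpath, -, rfl⟩ := hC.exists_isPath hfC
          obtain ⟨e, he, hes⟩ := hpath.exists_s_eq hp
          refine ⟨e, hes, fun h => hf ?_⟩
          rw [special_eq_of_s_eq hes, hsp] at h
          exact h ▸ he
        · exact ⟨f, rfl, hsp⟩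
      obtain ⟨w, hw⟩ := hC.reach hx hfC
      have hmany' : G.ManyPaths {g} (G.r g) (l.length + 1) :=
        (hmany.cycle hC hx).append (hw.append (hs ▸ isPath_singleton g)) rfl
      have := hmany'.ncard_ge hmany' (by rintro e rfl -; exact hg)
      rw [List.length_append, List.length_singleton] at hlen
      rwa [show 2 * d₂ = l.length + 1 + (l.length + 1) by omega]

/-! ### Exponential growth from two cycles with a common vertex -/

theorem IsPath.range_unique {x y z : V} {p : List E} (h : G.IsPath x p y) (hz : G.IsPath x p z) :
    y = z := by
  induction h with
  | nil => exact (isPath_nil_iff.1 hz).symm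
  | cons e _ ih => exact ih (isPath_cons_iff.1 hz).2

/-- A closed path without repeated vertices has no closed proper initial part. -/
theorem not_nodup_of_isPath_append {x : V} {a b : List E} (ha0 : a ≠ []) (hb0 : b ≠ [])
    (ha : G.IsPath x a x) (hab : G.IsPath x (a ++ b) x) : ¬ ((a ++ b).map G.s).Nodup := by
  intro hnd
  obtain ⟨z, ha', hb⟩ := isPath_append_iff.1 hab
  obtain rfl := ha.range_unique ha'
  obtain ⟨e, he, hex⟩ := ha.exists_s_eq ha0
  obtain ⟨f, hf, hfx⟩ := hb.exists_s_eq hb0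
  rw [List.map_append] at hnd
  exact (List.disjoint_of_nodup_append hnd) (List.mem_map_of_mem he)
    (by rw [hex, ← hfx]; exact List.mem_map_of_mem hf)

/-- These are the words of length N in u and w; equal lengths make the factorization unique. -/
theorem exists_two_pow_isPath {x : V} {u w : List E} (hu : G.IsPath x u x) (hw : G.IsPath x w x)
    (hlen : u.length = w.length) (hne : u ≠ w) (N : ℕ) :
    ∃ Q : Finset (List E), Q.card = 2 ^ N ∧ ∀ q ∈ Q, G.IsPath x q x ∧ q.length = u.length * N := by
  classical
  induction N with
  | zero => exact ⟨{[]}, by simp, by simp [isPath_nil_iff]⟩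
  | succ N ih =>
    obtain ⟨Q, hcard, hQ⟩ := ih
    refine ⟨Q.image (u ++ ·) ∪ Q.image (w ++ ·), ?_, ?_⟩
    · rw [Finset.card_union_of_disjoint, Finset.card_image_of_injective _
        (List.append_right_injective _), Finset.card_image_of_injective _
        (List.append_right_injective _), hcard, pow_succ, mul_two]
      rw [Finset.disjoint_left]
      simp only [Finset.mem_image]
      rintro _ ⟨q, -, rfl⟩ ⟨q', -, h⟩
      exact hne (List.append_inj_left h hlen.symm).symm
    · simp only [Finset.mem_union, Finset.mem_image]
      rintro _ (⟨q, hq, rfl⟩ | ⟨q, hq, rfl⟩)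
      · exact ⟨hu.append (hQ q hq).1, by rw [List.length_append, (hQ q hq).2]; ring⟩
      · exact ⟨hw.append (hQ q hq).1, by rw [List.length_append, (hQ q hq).2, ← hlen]; ring⟩

/-- Two distinct cycles with a common vertex give exponentially many paths. -/
theorem exists_two_pow_le [Finite V] [Finite E] (H : ¬ G.CyclesDisjoint) :
    ∃ M, ∀ N, 2 ^ N ≤ (G.normalTriples (M * N)).ncard := by
  simp only [CyclesDisjoint] at H
  push Not at H
  obtain ⟨C, D, hC, hD, hne, hCD⟩ := H
  obtain ⟨x, hxC, hxD⟩ := Set.not_disjoint_iff.1 hCD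
  obtain ⟨c, hc0, hc, hcn, rfl⟩ := hC.exists_isPath hxC
  obtain ⟨d, hd0, hd, hdn, rfl⟩ := hD.exists_isPath hxD
  -- If c and d commuted, one would be an initial part of the other, hence equal to it, since a
  -- cycle has no proper closed initial part.
  have hcd : c ++ d ≠ d ++ c := by
    intro h
    rcases List.append_eq_append_iff.1 h with ⟨a, rfl, -⟩ | ⟨a, rfl, -⟩
    · by_cases ha : a = []
      · exact hne (by rw [ha, List.append_nil])
      · exact not_nodup_of_isPath_append hc0 ha hc hd hdn
    · by_cases ha : a = []
      · exact hne (by rw [ha, List.append_nil])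
      · exact not_nodup_of_isPath_append hd0 ha hd hc hcn
  refine ⟨(c ++ d).length, fun N => ?_⟩
  obtain ⟨P, hcard, hP⟩ := exists_two_pow_isPath (hc.append hd) (hd.append hc)
    (by rw [List.length_append, List.length_append, add_comm]) hcd N
  have := ncard_normalTriples_ge (P := P) (Q := {[]}) (x := x) (n := (c ++ d).length * N)
    fun p hp q hq => by
      obtain rfl : q = [] := by simpa using hq
      refine ⟨⟨(hP p hp).1.isPathTo, trivial, by simp⟩, ?_⟩
      simp [tripleLength, (hP p hp).2]
  simpa [hcard] using this

end DirectedGraph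

/-! ## Growth and Gelfand-Kirillov dimension -/

-- A constant factor γ adds log γ / log n to the logarithm, which tends to 0, so only the exponent D
-- survives.
open Filter Topology in
theorem Real.tendsto_logb_of_pow_bounds {g : ℕ → ℝ} {D : ℕ} {α β : ℝ} (hα : 0 < α) (hβ : 0 < β)
    (h : ∀ᶠ n : ℕ in atTop, α * (n : ℝ) ^ D ≤ g n ∧ g n ≤ β * (n : ℝ) ^ D) :
    Tendsto (fun n : ℕ => Real.logb n (g n)) atTop (𝓝 D) := by
  have hlog : Tendsto (fun n : ℕ => Real.log n) atTop atTop :=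
    Real.tendsto_log_atTop.comp tendsto_natCast_atTop_atTop
  have hlim : ∀ γ : ℝ, Tendsto (fun n : ℕ => Real.log γ / Real.log n + D) atTop (𝓝 D) := fun γ => by
    simpa using (hlog.const_div_atTop (Real.log γ)).add_const (D : ℝ)
  have hform : ∀ γ : ℝ, 0 < γ → ∀ n : ℕ, 1 < n →
      Real.logb n (γ * (n : ℝ) ^ D) = Real.log γ / Real.log n + D := by
    intro γ hγ n hn
    have hn' : (1 : ℝ) < n := by exact_mod_cast hn
    have hl : Real.log n ≠ 0 := (Real.log_pos hn').ne'
    rw [Real.logb, Real.log_mul hγ.ne' (by positivity), Real.log_pow]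
    field_simp
  refine tendsto_of_tendsto_of_tendsto_of_le_of_le' (hlim α) (hlim β) ?_ ?_
  · filter_upwards [h, eventually_gt_atTop 1] with n hn hn1
    rw [← hform α hα n hn1]
    have hn' : (1 : ℝ) < n := by exact_mod_cast hn1
    exact Real.logb_le_logb_of_le hn' (by positivity) hn.1
  · filter_upwards [h, eventually_gt_atTop 1] with n hn hn1
    rw [← hform β hβ n hn1]
    have hn' : (1 : ℝ) < n := by exact_mod_cast hn1
    exact Real.logb_le_logb_of_le hn' (lt_of_lt_of_le (by positivity) hn.1) hn.2

namespace Growth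

open Filter Topology

variable {K : Type v} [Field K] {A : Type u} [NonUnitalRing A] [Module K A] {W : Submodule K A}

theorem hasPolynomialGrowth_of_le {b c D : ℕ} (h : ∀ n, growthFun W n ≤ b * (c * n + 1) ^ D) :
    HasPolynomialGrowth W := by
  -- The exponent has to be positive, hence D + 1. A single constant must serve inside and outside;
  -- b + c + 1 also absorbs the added 1, as n ≥ 1.
  refine ⟨D + 1, Nat.succ_pos _, b + c + 1, Nat.succ_pos _, fun n hn => ?_⟩
  have : growthFun W n ≤ (b + c + 1) * ((b + c + 1) * n) ^ (D + 1) := by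
    refine (h n).trans (Nat.mul_le_mul (by omega) ?_)
    have h₁ : c * n + 1 ≤ (b + c + 1) * n := by nlinarith
    exact (Nat.pow_le_pow_left h₁ D).trans (Nat.pow_le_pow_right (by positivity) (Nat.le_succ D))
  beta_reduce
  exact_mod_cast this

theorem not_hasPolynomialGrowth_of_two_pow_le {L : ℕ}
    (h : ∀ N, 0 < N → 2 ^ N ≤ growthFun W (L * N)) (hL : 0 < L) : ¬ HasPolynomialGrowth W := by
  rintro ⟨m, -, a, ha, hg⟩
  set B : ℝ := a * (a * L) ^ m with hB
  have hBpos : 0 < B := by positivity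
  have hle : ∀ N : ℕ, 0 < N → (2 : ℝ) ^ N ≤ B * (N : ℝ) ^ m := by
    intro N hN
    have h₁ : ((2 ^ N : ℕ) : ℝ) ≤ growthFun W (L * N) := by exact_mod_cast h N hN
    have h₂ := hg (L * N) (Nat.mul_pos hL hN)
    push_cast at h₁ h₂
    calc (2 : ℝ) ^ N ≤ _ := h₁
      _ ≤ _ := h₂
      _ = B * (N : ℝ) ^ m := by rw [hB, ← mul_assoc, mul_pow, mul_assoc]
  have hlim := tendsto_pow_const_div_const_pow_of_one_lt m (one_lt_two : (1 : ℝ) < 2)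
  obtain ⟨N, hN, hN0⟩ := ((hlim.eventually (gt_mem_nhds (inv_pos.2 hBpos))).and
    (eventually_gt_atTop 0)).exists
  have h₁ := hle N hN0
  rw [div_lt_iff₀ (by positivity), inv_mul_eq_div, lt_div_iff₀ hBpos] at hN
  linarith [mul_comm B ((N : ℝ) ^ m)]

theorem gkDim_eq_of_bounds {b c D L : ℕ} (hmono : Monotone (growthFun W)) (hL : 0 < L)
    (hup : ∀ n, growthFun W n ≤ b * (c * n + 1) ^ D)
    (hlow : ∀ N, N ^ D ≤ growthFun W (L * (N + 1))) : gkDim W = ((D : ℝ) : EReal) := by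
  -- If N + 1 is the integer part of n / L and n ≥ 4 L, then N > n / L - 2 ≥ n / (2 L), which gives
  -- α. In β, b + 1 ensures positivity and c + 1 absorbs the added 1.
  refine Tendsto.limsup_eq ((continuous_coe_real_ereal.tendsto _).comp
    (Real.tendsto_logb_of_pow_bounds (α := ((2 * L : ℝ)⁻¹) ^ D)
      (β := (b + 1 : ℝ) * (c + 1) ^ D) (by positivity) (by positivity) ?_))
  filter_upwards [eventually_ge_atTop (4 * L)] with n hn
  have hLr : (0 : ℝ) < L := by exact_mod_cast hL
  have hnr : 4 * (L : ℝ) ≤ n := by exact_mod_cast hn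
  constructor
  · obtain ⟨N, hN⟩ : ∃ N, n / L = N + 1 :=
      Nat.exists_eq_add_of_le' ((Nat.one_le_div_iff hL).2 (by omega))
    have h₁ : N ^ D ≤ growthFun W n := (hlow N).trans (hmono (hN ▸ Nat.mul_div_le n L))
    have h₂ : n < L * (N + 2) := by
      have := Nat.lt_mul_div_succ n hL
      rwa [hN] at this
    have h₃ : (n : ℝ) < L * (N + 2) := by exact_mod_cast h₂
    have h₄ : (2 * L : ℝ)⁻¹ * n ≤ N := by
      rw [inv_mul_eq_div, div_le_iff₀ (by positivity)]
      nlinarith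
    rw [← mul_pow]
    calc ((2 * L : ℝ)⁻¹ * n) ^ D ≤ (N : ℝ) ^ D := pow_le_pow_left₀ (by positivity) h₄ D
      _ ≤ growthFun W n := by exact_mod_cast h₁
  · have h₁ : (growthFun W n : ℝ) ≤ b * (c * n + 1) ^ D := by exact_mod_cast hup n
    have hn1 : (1 : ℝ) ≤ n := by exact_mod_cast (show 1 ≤ n by omega)
    rw [mul_assoc, ← mul_pow]
    refine h₁.trans (mul_le_mul (by linarith) (pow_le_pow_left₀ (by positivity) ?_ D)
      (by positivity) (by positivity))
    linarith [add_mul (c : ℝ) 1 n]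

end Growth

/-! ### Proof of the theorem -/

theorem Nat.exists_isGreatest {S : Set ℕ} (h : S.Nonempty) (h' : BddAbove S) :
    ∃ d, IsGreatest S d :=
  ⟨sSup S, Nat.sSup_mem h h', fun _ hk => le_csSup h' hk⟩

theorem mainTheorem3 {K : Type*} [Field K] {V E : Type*}
    [Finite V] [Nonempty V] [Finite E] (G : DirectedGraph V E) :
    -- growth and dimension are defined: finite-dimensional generating spaces exist,
    (∃ W : Submodule K (LeavittPathAlgebra K G), Growth.IsGeneratingSpace W) ∧
    -- and so do the two maximal lengths;
    ∃ d₁ d₂ : ℕ, G.IsMaxChainLength d₁ ∧ G.IsMaxChainWithExitLength d₂ ∧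
      -- growth and dimension may be computed on any generating space
      ∀ W : Submodule K (LeavittPathAlgebra K G), Growth.IsGeneratingSpace W →
        (Growth.HasPolynomialGrowth W ↔
          ∀ C D : G.Subgraph, C.IsCycle → D.IsCycle → C ≠ D → Disjoint C.verts D.verts) ∧
        (Growth.HasPolynomialGrowth W →
          Growth.gkDim W = ((max (2 * (d₁ : ℝ) - 1) (2 * (d₂ : ℝ)) : ℝ) : EReal)) := by
  cases nonempty_fintype E
  refine ⟨⟨_, LeavittPathAlgebra.isGeneratingSpace_genSpace K G⟩, ?_⟩
  obtain ⟨d₁, h₁⟩ : ∃ d, G.IsMaxChainLength d := by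
    refine Nat.exists_isGreatest ⟨0, [], DirectedGraph.isCycleChain_nil, rfl⟩
      ⟨Nat.card G.Subgraph, ?_⟩
    rintro k ⟨l, hl, rfl⟩
    exact hl.length_le
  obtain ⟨d₂, h₂⟩ : ∃ d, G.IsMaxChainWithExitLength d := by
    refine Nat.exists_isGreatest ⟨0, [], DirectedGraph.isCycleChain_nil,
      by simp [DirectedGraph.ChainHasExit], rfl⟩ ⟨Nat.card G.Subgraph, ?_⟩
    rintro k ⟨l, hl, -, rfl⟩
    exact hl.length_le
  refine ⟨d₁, d₂, h₁, h₂, fun W hW => ?_⟩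
  obtain ⟨hmono, c, hc, hT⟩ := LeavittPathAlgebra.growthFun_bounds K hW
  have hpoly : G.CyclesDisjoint → ∃ b, ∀ n, Growth.growthFun W n ≤
      b * (c * n + 1) ^ max (2 * d₁ - 1) (2 * d₂) := by
    intro H
    obtain ⟨b, hb⟩ := H.ncard_normalTriples_le h₁ h₂
    exact ⟨b, fun n => (hT n).1.trans (hb _)⟩
  have hiff : Growth.HasPolynomialGrowth W ↔ G.CyclesDisjoint := by
    refine ⟨fun hg => ?_, fun H => ?_⟩
    · by_contra H
      obtain ⟨M, hM⟩ := DirectedGraph.exists_two_pow_le H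
      -- As N > 0, M N + 1 ≤ (M + 1) N; this absorbs the shift in `growthFun_bounds`.
      refine Growth.not_hasPolynomialGrowth_of_two_pow_le (L := c * (M + 1)) (fun N hN => ?_)
        (Nat.mul_pos hc (Nat.succ_pos M)) hg
      refine (hM N).trans ((hT _).2.trans (hmono ?_))
      rw [mul_assoc]
      exact Nat.mul_le_mul_left c (by rw [add_mul]; omega)
    · obtain ⟨b, hb⟩ := hpoly H
      exact Growth.hasPolynomialGrowth_of_le hb
  refine ⟨hiff, fun hg => ?_⟩
  have H := hiff.1 hg
  obtain ⟨b, hb⟩ := hpoly H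
  obtain ⟨M, hM⟩ := H.le_ncard_normalTriples h₁ h₂
  rw [Growth.gkDim_eq_of_bounds hmono (Nat.mul_pos hc (Nat.succ_pos M)) hb fun N => ?_]
  · congr 1
    -- For d₁ = 0 the truncated 2 d₁ - 1 is 0 and the real one is -1; the maximum with 2 d₂ ≥ 0 is
    -- the same.
    obtain _ | d := d₁
    · have : (0 : ℝ) ≤ d₂ := Nat.cast_nonneg d₂
      rw [max_eq_right (by omega), max_eq_right (by push_cast; linarith)]
      push_cast
      rfl
    · rw [show 2 * (d + 1) - 1 = 2 * d + 1 by omega]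
      push_cast
      congr 1
      ring
  · refine (hM N).trans ((hT _).2.trans (hmono ?_))
    rw [mul_assoc]
    exact Nat.mul_le_mul_left c (by rw [Nat.succ_mul]; omega)
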